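/- Let $k$ be a field, let $n\ge 1$, and let $\delta,\delta_L,\delta_R,\kappa_L,\kappa_R,\kappa_{LR}\in k$ be arbitrary. Consider $(n,n)$ Temperley--Lieb diagrams (non-crossing pairings, by lines inside a rectangle, of $n$ vertices on the top edge and $n$ vertices on the bottom edge), in which the lines may carry left blobs $L$ and right blobs $R$ in such a way that the lines can be deformed, without crossings, so that simultaneously all left blobs touch the left edge and all right blobs touch the right edge of the rectangle. Let $B_n$ be the set of those diagrams (without loops) in which the word of blobs along a line never contains $LL$, $RR$, $LRL$ or $RLR$, and in which there are not both a line with the two endpoints on the top edge and a line with the two endpoints on the bottom edge that each carry both an $L$ and an $R$. The symplectic blob algebra $b_n=b_n(\delta,\delta_L,\delta_R,\kappa_L,\kappa_R,\kappa_{LR})$ is the $k$-algebra with basis $B_n$ whose product is vertical concatenation of diagrams (the first factor on top), followed by these replacements: * on each loop, consecutive equal blobs are merged, $LL\mapsto\delta_L L$ and $RR\mapsto\delta_R R$, and then the loop is replaced by $\delta$ if it has no blob, by $\kappa_L$ if it has only a left blob, by $\kappa_R$ if it has only a right blob, and by $\kappa_{LR}$ if it has one of each; * on each open line, $LL\mapsto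 \delta_L L$, $RR\mapsto\delta_R R$, $LRL\mapsto\kappa_{LR}L$, $RLR\mapsto \kappa_{LR}R$; * a diagram with a line $\{u,u'\}$ on the top and a line $\{v,v'\}$ on the bottom, both carrying an $L$ (next to $u$, respectively $v$) and an $R$ (next to $u'$, respectively $v'$), is replaced by $\kappa_{LR}$ times the diagram in which these two lines are replaced by the line $\{u,v\}$ carrying $L$ and the line $\{u',v'\}$ carrying $R$. Let $e$ (respectively $f$) be the diagram with $n$ vertical lines whose only blob is an $L$ on the first (respectively an $R$ on the last) line, and for $1\le i\le n-1$ let $e_i$ be the diagram without blobs in which the vertices $i$ and $i+1$ on the top are joined, the vertices $i$ and $i+1$ on the bottom are joined, and all the other lines are vertical. Then $b_n$ is generated, as a unital $k$-algebra, by $e,e_1,\dots,e_{n-1},f$. -/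

import Mathlib

namespace SymplecticBlob

/-- The two decorations: the left blob and the right blob. -/
inductive Blob
  | L
  | R
  deriving DecidableEq

/-- A partition of `V` into pairs ("lines"), each line carrying a word in the free monoid on the
two blobs. `partner v` is the other endpoint of the line at `v`, and `word v` is the word read
along this line from `v` to `partner v`. -/
@[ext]
structure Decorated (V : Type) where
  partner : V → V
  word : V → List Blob
  partner_partner : ∀ v, partner (partner v) = v
  partner_ne : ∀ v, partner v ≠ v
  word_partner : ∀ v, word (partner v) = (word v).reverse

/-- The vertices of an `(n,n)`-diagram: `Sum.inl i` is the `(i+1)`-st vertex on the top edge and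
`Sum.inr i` is the `(i+1)`-st vertex on the bottom edge, both counted from the left. -/
abbrev Vertex (n : ℕ) : Type := Fin n ⊕ Fin n

/-- Decorated pair partitions of the vertices of the rectangle (possibly with crossings). -/
abbrev Diagram (n : ℕ) : Type := Decorated (Vertex n)

/-- Position on the frame, clockwise from the left edge of the rectangle: the top vertices from
left to right have positions `0, …, n-1`, then comes the right edge, then the bottom vertices from
right to left have positions `n, …, 2n-1`, and then comes the left edge again. -/
def pos {n : ℕ} : Vertex n → ℕ
  | Sum.inl i => i
  | Sum.inr i => 2 * n - 1 - i

/-! ### Left-right blob diagrams -/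

section Basis

variable {n : ℕ}

/-- The vertex `v` lies strictly between the endpoints of the line `{u, partner u}`, on the side of
that line that does not contain the left edge (`u` being its endpoint of smaller position). -/
def Diagram.Inside (d : Diagram n) (u v : Vertex n) : Prop :=
  pos u < pos v ∧ pos v < pos (d.partner u)

/-- No two lines cross. -/
def Diagram.Noncrossing (d : Diagram n) : Prop :=
  ∀ u v, d.Inside u v → d.Inside u (d.partner v)

/-- The line at `v` can be deformed to touch the left edge of the frame: no line separates the two.
-/
def Diagram.LExposed (d : Diagram n) (v : Vertex n) : Prop :=
  ∀ u, ¬ d.Inside u v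

/-- The line at `v` can be deformed to touch the right edge of the frame: no other line separates
the two. The right edge lies between the positions `n-1` and `n`. -/
def Diagram.RExposed (d : Diagram n) (v : Vertex n) : Prop :=
  ∀ u, pos u < pos (d.partner u) → u ≠ v → d.partner u ≠ v →
    (d.Inside u v ↔ pos u < n ∧ n ≤ pos (d.partner u))

/-- All the decorated segments can be deformed simultaneously so that the left blobs touch the left
edge and the right blobs touch the right edge. If the first blob met from a vertex is a left
(right) blob, the segment up to it becomes a path from that vertex to the left (right) edge. On
exposed lines, such paths are forced to cross exactly if they start on the same edge of the
rectangle and the one that goes to the right edge starts further to the left. -/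
def Diagram.Simultaneous (d : Diagram n) : Prop :=
  (∀ i j : Fin n, (d.word (Sum.inl i)).head? = some Blob.L →
    (d.word (Sum.inl j)).head? = some Blob.R → i < j) ∧
  (∀ i j : Fin n, (d.word (Sum.inr i)).head? = some Blob.L →
    (d.word (Sum.inr j)).head? = some Blob.R → i < j)

/-- The word contains none of the features `LL`, `RR`, `LRL`, `RLR`. -/
def FeatureFree (w : List Blob) : Prop :=
  ∀ x y : Blob, ¬ [x, x] <:+: w ∧ ¬ [x, y, x] <:+: w

/-- The left-right blob diagrams, the set `B'_n`. (There are no loops, by construction.) -/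
structure Diagram.IsLeftRightBlob (d : Diagram n) : Prop where
  noncrossing : d.Noncrossing
  left_exposed : ∀ v, Blob.L ∈ d.word v → d.LExposed v
  right_exposed : ∀ v, Blob.R ∈ d.word v → d.RExposed v
  simultaneous : d.Simultaneous
  featureFree : ∀ v, FeatureFree (d.word v)

/-- A non-propagating line at the top (one endpoint of which is the vertex `i`) and a
non-propagating line at the bottom (one endpoint of which is the vertex `j`) both carry a left and
a right blob; `i` and `j` are the endpoints next to the left blobs. -/
def Diagram.TopBottomLR (d : Diagram n) (i j : Fin n) : Prop :=
  d.word (Sum.inl i) = [Blob.L, Blob.R] ∧ (d.partner (Sum.inl i)).isLeft = true ∧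
  d.word (Sum.inr j) = [Blob.L, Blob.R] ∧ (d.partner (Sum.inr j)).isRight = true

/-- The basis `B_n` of the symplectic blob algebra. -/
def IsBasisDiagram (d : Diagram n) : Prop :=
  d.IsLeftRightBlob ∧ ∀ i j, ¬ d.TopBottomLR i j

end Basis

/-- The type of basis diagrams, the set `B_n`. -/
abbrev BasisDiagram (n : ℕ) : Type := {d : Diagram n // IsBasisDiagram d}

/-! ### Concatenation -/

section Concatenation

variable {V W : Type}

/-- Two decorated pair partitions side by side. -/
def Decorated.disjointUnion (d : Decorated V) (d' : Decorated W) : Decorated (V ⊕ W) where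
  partner := Sum.map d.partner d'.partner
  word := Sum.elim d.word d'.word
  partner_partner := by
    rintro (v | v) <;> simp [d.partner_partner, d'.partner_partner]
  partner_ne := by
    rintro (v | v) <;> simp [d.partner_ne, d'.partner_ne]
  word_partner := by
    rintro (v | v) <;> simp [d.word_partner, d'.word_partner]

/-- Identify the distinct vertices `a` and `b`. The lines ending there are combined to one line from
`partner a` to `partner b`, and their words are multiplied in the order of the line. (If `a` and `b`
are the two ends of one line, this line becomes a loop and disappears.) The vertices `a` and `b`,
which are now interior, are kept as a dummy undecorated pair. -/
def Decorated.join [DecidableEq V] (d : Decorated V) (a b : V) (hab : a ≠ b) : Decorated V where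
  partner x :=
    if x = a then b
    else if x = b then a
    else if x = d.partner a then d.partner b
    else if x = d.partner b then d.partner a
    else d.partner x
  word x :=
    if x = a then []
    else if x = b then []
    else if x = d.partner a then d.word x ++ d.word b
    else if x = d.partner b then d.word x ++ d.word a
    else d.word x
  partner_partner := by
    intro x
    have := d.partner_partner
    have := d.partner_ne
    grind
  partner_ne := by
    intro x
    have := d.partner_partner
    have := d.partner_ne
    grind
  word_partner := by
    intro x
    have := d.partner_partner
    have := d.partner_ne
    have := d.word_partner
    grind

/-- The parameters `δ, δ_L, δ_R, κ_L, κ_R, κ_LR = k_L = k_R`. -/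
structure Parameters (k : Type*) where
  δ : k
  δL : k
  δR : k
  κL : k
  κR : k
  κLR : k

variable {k : Type*} [Field k] (P : Parameters k)

/-- The scalar by which a loop is replaced. Consecutive equal blobs on the loop are merged, with a
factor `δ_L` or `δ_R` each, and then a loop without blobs gives `δ`, one with a left blob only
`κ_L`, one with a right blob only `κ_R`, and one with both `κ_LR`. (On a loop in a concatenation of
left-right blob diagrams, all the left blobs are consecutive, and so are all the right blobs.) -/
def Parameters.loopValue (w : List Blob) : k :=
  P.δL ^ (w.count Blob.L - 1) * P.δR ^ (w.count Blob.R - 1) *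
    if Blob.L ∈ w then (if Blob.R ∈ w then P.κLR else P.κL)
    else (if Blob.R ∈ w then P.κR else P.δ)

/-- Straightening of the word `x w`, for a word `w` without features: `LL ↦ δ_L L`, `RR ↦ δ_R R`,
`LRL ↦ κ_LR L`, `RLR ↦ κ_LR R`. The result is a scalar and a word. -/
def Parameters.straightenCons : Blob → List Blob → k × List Blob
  | Blob.L, Blob.L :: w => (P.δL, Blob.L :: w)
  | Blob.R, Blob.R :: w => (P.δR, Blob.R :: w)
  | Blob.L, Blob.R :: Blob.L :: w => (P.κLR, Blob.L :: w)
  | Blob.R, Blob.L :: Blob.R :: w => (P.κLR, Blob.R :: w)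
  | x, w => (1, x :: w)

/-- Straightening of the word on an open line: `(c, w')` stands for `c` times the word `w'`. -/
def Parameters.straighten : List Blob → k × List Blob
  | [] => (1, [])
  | x :: w =>
    ((Parameters.straighten w).1 * (P.straightenCons x (Parameters.straighten w).2).1,
      (P.straightenCons x (Parameters.straighten w).2).2)

/-- The straightened word depends only on the first and the last blob. -/
def endBlobs (w : List Blob) : List Blob :=
  match w.head?, w.getLast? with
  | some x, some y => if x = y then [x] else [x, y]
  | _, _ => []

theorem straighten_snd (w : List Blob) : (P.straighten w).2 = endBlobs w := by
  induction w with
  | nil => rfl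
  | cons x w ih =>
    rw [Parameters.straighten, ih]
    rcases w with _ | ⟨y, w⟩
    · cases x <;> rfl
    · obtain ⟨z, hz⟩ : ∃ z, (y :: w).getLast? = some z := ⟨_, List.getLast?_eq_some_getLast (by simp)⟩
      have hz' : (x :: y :: w).getLast? = some z := by
        rw [List.getLast?_cons_cons, hz]
      simp only [endBlobs, hz, hz', List.head?_cons]
      cases x <;> cases y <;> cases z <;> rfl

theorem straighten_reverse (w : List Blob) :
    (P.straighten w.reverse).2 = (P.straighten w).2.reverse := by
  rw [straighten_snd, straighten_snd]
  simp only [endBlobs, List.head?_reverse, List.getLast?_reverse]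
  rcases w.head? with _ | x <;> rcases w.getLast? with _ | y <;> try rfl
  cases x <;> cases y <;> rfl

/-- Straighten the words on all the lines (without the scalars). -/
def Decorated.straightenWords (d : Decorated V) : Decorated V where
  partner := d.partner
  word v := (P.straighten (d.word v)).2
  partner_partner := d.partner_partner
  partner_ne := d.partner_ne
  word_partner v := by rw [d.word_partner, straighten_reverse]

variable {n : ℕ}

/-- The product of the scalars that arise when the words on all the lines are straightened; each
line is read from its endpoint of smaller position. -/
def Diagram.straightenScalar (d : Diagram n) : k :=
  ∏ v with pos v < pos (d.partner v), (P.straighten (d.word v)).1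

/-- The bottom vertex `i` of the upper one of two diagrams. -/
def upperMid (i : Fin n) : Vertex n ⊕ Vertex n := Sum.inl (Sum.inr i)

/-- The top vertex `i` of the lower one of two diagrams. -/
def lowerMid (i : Fin n) : Vertex n ⊕ Vertex n := Sum.inr (Sum.inl i)

/-- The vertices of a concatenation among the vertices of its two factors. -/
def outer : Vertex n → Vertex n ⊕ Vertex n
  | Sum.inl i => Sum.inl (Sum.inl i)
  | Sum.inr i => Sum.inr (Sum.inr i)

theorem upperMid_ne_lowerMid (i j : Fin n) : upperMid i ≠ lowerMid j := by
  simp [upperMid, lowerMid]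

/-- Identify the bottom vertex `i` of the upper diagram with the top vertex `i` of the lower one,
and multiply the scalar by the value of the loop if this closes a loop. -/
def glueStep (s : k × Decorated (Vertex n ⊕ Vertex n)) (i : Fin n) :
    k × Decorated (Vertex n ⊕ Vertex n) :=
  (s.1 * (if s.2.partner (upperMid i) = lowerMid i then P.loopValue (s.2.word (upperMid i)) else 1),
    s.2.join (upperMid i) (lowerMid i) (upperMid_ne_lowerMid i i))

/-- Put `d` on top of `d'` and identify the bottom vertices of `d` with the top vertices of `d'`. -/
def glue (d d' : Diagram n) : k × Decorated (Vertex n ⊕ Vertex n) :=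
  (List.finRange n).foldl (glueStep P) (1, d.disjointUnion d')

theorem foldl_partner (l : List (Fin n)) (s : k × Decorated (Vertex n ⊕ Vertex n)) (i : Fin n)
    (h : i ∈ l ∨ s.2.partner (upperMid i) = lowerMid i) :
    (l.foldl (glueStep P) s).2.partner (upperMid i) = lowerMid i := by
  induction l generalizing s with
  | nil => simpa using h
  | cons j l ih =>
    rw [List.foldl_cons]
    apply ih
    by_cases hij : i = j
    · right
      subst hij
      simp [glueStep, Decorated.join]
    · rcases h with h | h
      · left
        simpa [hij] using h
      · right
        have h1 : upperMid i ≠ upperMid j := by simpa [upperMid] using hij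
        have h2 : lowerMid i ≠ lowerMid j := by simpa [lowerMid] using hij
        have h3 := upperMid_ne_lowerMid i j
        have h4 := upperMid_ne_lowerMid j i
        have := s.2.partner_partner
        simp only [glueStep, Decorated.join]
        grind

theorem glue_partner (d d' : Diagram n) (i : Fin n) :
    (glue P d d').2.partner (upperMid i) = lowerMid i :=
  foldl_partner P _ _ _ (Or.inl (List.mem_finRange i))

theorem exists_outer (d d' : Diagram n) (v : Vertex n) :
    ∃ u, (glue P d d').2.partner (outer v) = outer u := by
  have h := glue_partner P d d'
  have h' := (glue P d d').2.partner_partner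
  rcases hx : (glue P d d').2.partner (outer v) with (i | i) | (i | i)
  · exact ⟨Sum.inl i, rfl⟩
  · exfalso
    have h1 := h' (outer v)
    rw [hx] at h1
    have h2 := (h i).symm.trans h1
    rcases v with v | v <;> simp [outer, lowerMid] at h2
  · exfalso
    have h1 := h' (outer v)
    rw [hx] at h1
    have h2 := h' (upperMid i)
    rw [h i] at h2
    have h3 := h2.symm.trans h1
    rcases v with v | v <;> simp [outer, upperMid] at h3
  · exact ⟨Sum.inr i, rfl⟩

/-- Forget the interior vertices. (No outer vertex is joined to an interior one by `exists_outer`.)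
-/
def outerPart : Vertex n ⊕ Vertex n → Vertex n
  | Sum.inl (Sum.inl i) => Sum.inl i
  | Sum.inr (Sum.inr i) => Sum.inr i
  | Sum.inl (Sum.inr i) => Sum.inr i
  | Sum.inr (Sum.inl i) => Sum.inl i

theorem outerPart_outer (v : Vertex n) : outerPart (outer v) = v := by
  rcases v with v | v <;> rfl

theorem outer_outerPart (d d' : Diagram n) (v : Vertex n) :
    outer (outerPart ((glue P d d').2.partner (outer v))) =
      (glue P d d').2.partner (outer v) := by
  obtain ⟨u, hu⟩ := exists_outer P d d' v
  rw [hu, outerPart_outer]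

/-- The concatenation of `d` (above) and `d'` (below), loops removed, words not yet straightened. -/
def concat (d d' : Diagram n) : Diagram n where
  partner v := outerPart ((glue P d d').2.partner (outer v))
  word v := (glue P d d').2.word (outer v)
  partner_partner v := by
    rw [outer_outerPart, (glue P d d').2.partner_partner, outerPart_outer]
  partner_ne v h := by
    have h1 := congrArg outer h
    rw [outer_outerPart] at h1
    exact (glue P d d').2.partner_ne _ h1
  word_partner v := by
    rw [outer_outerPart, (glue P d d').2.word_partner]

/-- If the lines `{u, u'}` and `{v, v'}` are different, replace them by the lines `{u, v}`, decorated
by a left blob, and `{u', v'}`, decorated by a right blob. -/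
def Decorated.reconnect [DecidableEq V] (d : Decorated V) (u v : V) (h : v ≠ u)
    (h' : v ≠ d.partner u) : Decorated V where
  partner x :=
    if x = u then v
    else if x = v then u
    else if x = d.partner u then d.partner v
    else if x = d.partner v then d.partner u
    else d.partner x
  word x :=
    if x = u ∨ x = v then [Blob.L]
    else if x = d.partner u ∨ x = d.partner v then [Blob.R]
    else d.word x
  partner_partner := by
    intro x
    have := d.partner_partner
    have := d.partner_ne
    grind
  partner_ne := by
    intro x
    have := d.partner_partner
    have := d.partner_ne
    grind
  word_partner := by
    intro x
    have := d.partner_partner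
    have := d.partner_ne
    have := d.word_partner
    grind

theorem Diagram.TopBottomLR.ne_partner {d : Diagram n} {i j : Fin n} (h : d.TopBottomLR i j) :
    Sum.inr j ≠ d.partner (Sum.inl i) := by
  intro h1
  have h2 := h.2.1
  rw [← h1] at h2
  simp at h2

end Concatenation

/-! ### The algebra -/

/-- The symplectic blob algebra `b_n(δ, δ_L, δ_R, κ_L, κ_R, κ_LR)`: the `k`-space with basis `B_n`. -/
def SymplecticBlobAlgebra {k : Type*} [Field k] (_P : Parameters k) (n : ℕ) : Type _ :=
  BasisDiagram n →₀ k

noncomputable section Algebra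

variable {k : Type*} [Field k] (P : Parameters k) {n : ℕ}

instance : AddCommGroup (SymplecticBlobAlgebra P n) :=
  inferInstanceAs (AddCommGroup (BasisDiagram n →₀ k))

instance : Module k (SymplecticBlobAlgebra P n) :=
  inferInstanceAs (Module k (BasisDiagram n →₀ k))

/-- The basis of the algebra by the diagrams in `B_n`. -/
def diagramBasis : Module.Basis (BasisDiagram n) k (SymplecticBlobAlgebra P n) :=
  ⟨LinearEquiv.refl k (BasisDiagram n →₀ k)⟩

open Classical in
/-- A diagram of `B_n` as an element of the algebra. (The value `0` on other diagrams is never used: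
the straightened concatenations of diagrams of `B_n` are again in `B_n`.) -/
def ofDiagram (d : Diagram n) : SymplecticBlobAlgebra P n :=
  if h : IsBasisDiagram d then diagramBasis P ⟨d, h⟩ else 0

open Classical in
/-- The topological relation: a diagram in which a line at the top from `u` to `u'` and a line at the
bottom from `v` to `v'` both carry a left blob followed by a right blob is `κ_LR` times the diagram
in which they are replaced by the propagating lines `{u, v}` with a left blob and `{u', v'}` with a
right blob. Other diagrams are not changed. -/
def topological (d : Diagram n) : SymplecticBlobAlgebra P n :=
  if h : ∃ p : Fin n × Fin n, d.TopBottomLR p.1 p.2 then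
    P.κLR • ofDiagram P (d.reconnect (Sum.inl h.choose.1) (Sum.inr h.choose.2) (by simp)
      h.choose_spec.ne_partner)
  else ofDiagram P d

/-- The product of two basis diagrams: concatenate, replace the loops by scalars, straighten the
words on the lines, and apply the topological relation. -/
def basisMul (d d' : BasisDiagram n) : SymplecticBlobAlgebra P n :=
  ((glue P d.1 d'.1).1 * (concat P d.1 d'.1).straightenScalar P) •
    topological P ((concat P d.1 d'.1).straightenWords P)

/-- The bilinear extension of `basisMul`. -/
def mulMap : SymplecticBlobAlgebra P n →ₗ[k] SymplecticBlobAlgebra P n →ₗ[k]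
    SymplecticBlobAlgebra P n :=
  (diagramBasis P).constr k fun d => (diagramBasis P).constr k fun d' => basisMul P d d'

instance : Mul (SymplecticBlobAlgebra P n) := ⟨fun x y => mulMap P x y⟩

theorem mul_def (x y : SymplecticBlobAlgebra P n) : x * y = mulMap P x y := rfl

theorem basis_mul_basis (d d' : BasisDiagram n) :
    diagramBasis P d * diagramBasis P d' = basisMul P d d' := by
  rw [mul_def, mulMap, Module.Basis.constr_basis, Module.Basis.constr_basis]

/-- The bilinear product. (It is associative with identity `1`, the identity diagram, but neither is
needed to say which subspaces are subalgebras: those that contain `1` and are closed under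
products.) -/
instance : NonUnitalNonAssocRing (SymplecticBlobAlgebra P n) where
  left_distrib x y z := by simp only [mul_def, map_add]
  right_distrib x y z := by simp only [mul_def, map_add, LinearMap.add_apply]
  zero_mul x := by simp only [mul_def, map_zero, LinearMap.zero_apply]
  mul_zero x := by simp only [mul_def, map_zero]

instance : IsScalarTower k (SymplecticBlobAlgebra P n) (SymplecticBlobAlgebra P n) where
  smul_assoc c x y := by simp only [smul_eq_mul, mul_def, map_smul, LinearMap.smul_apply]

instance : SMulCommClass k (SymplecticBlobAlgebra P n) (SymplecticBlobAlgebra P n) where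
  smul_comm c x y := by simp only [smul_eq_mul, mul_def, map_smul]

end Algebra

/-! ### The generators -/

section Generators

variable {n : ℕ}

/-- Vertical lines `{i, i'}`, undecorated except for the word `w` on the line number `m`
(counted from `0`), where `w` has at most one blob. -/
def verticalDiagram (n m : ℕ) (w : List Blob) (hw : w.reverse = w) : Diagram n where
  partner := Sum.swap
  word := Sum.elim (fun i => if i.val = m then w else []) (fun i => if i.val = m then w else [])
  partner_partner := by rintro (i | i) <;> rfl
  partner_ne := by rintro (i | i) <;> simp
  word_partner := by rintro (i | i) <;> simp only [Sum.swap, Sum.elim] <;> split_ifs <;> simp [hw]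

/-- The identity diagram. -/
def identityDiagram (n : ℕ) : Diagram n := verticalDiagram n 0 [] rfl

/-- The diagram `e`: vertical lines, with a left blob on the first one. -/
def eDiagram (n : ℕ) : Diagram n := verticalDiagram n 0 [Blob.L] rfl

/-- The diagram `f`: vertical lines, with a right blob on the last one. -/
def fDiagram (n : ℕ) : Diagram n := verticalDiagram n (n - 1) [Blob.R] rfl

/-- The diagram `e_{i+1}`: undecorated, with lines joining the vertices number `i` and `i + 1`
(counted from `0`) on the top, the same two on the bottom, and vertical lines elsewhere. -/
def cupCapDiagram (n i : ℕ) (hi : i + 1 < n) : Diagram n where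
  partner
    | Sum.inl j => if j.val = i then Sum.inl ⟨i + 1, hi⟩
        else if j.val = i + 1 then Sum.inl ⟨i, Nat.lt_of_succ_lt hi⟩ else Sum.inr j
    | Sum.inr j => if j.val = i then Sum.inr ⟨i + 1, hi⟩
        else if j.val = i + 1 then Sum.inr ⟨i, Nat.lt_of_succ_lt hi⟩ else Sum.inl j
  word _ := []
  partner_partner := by
    rintro (j | j) <;> simp only <;> grind
  partner_ne := by
    rintro (j | j) <;> simp only <;> grind
  word_partner _ := rfl

theorem featureFree_of_length_le_one (w : List Blob) (hw : w.length ≤ 1) : FeatureFree w := by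
  intro x y
  constructor <;> intro h <;> have := h.length_le <;> simp at this <;> omega

theorem verticalDiagram_isBasisDiagram (n m : ℕ) (w : List Blob) (hw : w.reverse = w)
    (hlen : w.length ≤ 1) (hL : Blob.L ∈ w → m = 0) (hR : Blob.R ∈ w → m = n - 1) :
    IsBasisDiagram (verticalDiagram n m w hw) := by
  have hword : ∀ v, (verticalDiagram n m w hw).word v = [] ∨
      (verticalDiagram n m w hw).word v = w := by
    rintro (i | i) <;> simp only [verticalDiagram, Sum.elim] <;> split_ifs <;> simp
  refine ⟨⟨?_, ?_, ?_, ?_, ?_⟩, ?_⟩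
  · rintro (u | u) (v | v) <;>
      simp only [Diagram.Inside, verticalDiagram, Sum.swap_inl, Sum.swap_inr, pos] <;> omega
  · rintro (v | v) hv (u | u) <;> simp only [verticalDiagram, Sum.elim_inl, Sum.elim_inr] at hv <;>
      split_ifs at hv with h <;> try simp at hv
    all_goals
      have := hL hv
      simp only [Diagram.Inside, verticalDiagram, Sum.swap_inl, Sum.swap_inr, pos]
      omega
  · rintro (v | v) hv (u | u) <;> simp only [verticalDiagram, Sum.elim_inl, Sum.elim_inr] at hv <;>
      split_ifs at hv with h <;> try simp at hv
    all_goals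
      have := hR hv
      simp only [Diagram.Inside, verticalDiagram, Sum.swap_inl, Sum.swap_inr, pos, ne_eq,
        Sum.inl.injEq, Sum.inr.injEq, Fin.ext_iff]
      omega
  · have key : ∀ u v, ((verticalDiagram n m w hw).word u).head? = some Blob.L →
        ((verticalDiagram n m w hw).word v).head? = some Blob.R → False := by
      intro u v hu hv
      rcases hword u with h | h <;> rw [h] at hu <;> rcases hword v with h' | h' <;>
        rw [h'] at hv <;> simp_all
    exact ⟨fun i j hi hj => (key _ _ hi hj).elim, fun i j hi hj => (key _ _ hi hj).elim⟩
  · intro v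
    apply featureFree_of_length_le_one
    rcases hword v with h | h <;> rw [h] <;> simp [hlen]
  · intro i j h
    simpa [verticalDiagram] using h.2.1

theorem cupCapDiagram_isBasisDiagram (n i : ℕ) (hi : i + 1 < n) :
    IsBasisDiagram (cupCapDiagram n i hi) := by
  refine ⟨⟨?_, ?_, ?_, ?_, ?_⟩, ?_⟩
  · rintro (u | u) (v | v) <;> simp only [Diagram.Inside, cupCapDiagram] <;> split_ifs <;>
      simp only [pos] <;> omega
  · intro v hv
    simp [cupCapDiagram] at hv
  · intro v hv
    simp [cupCapDiagram] at hv
  · constructor <;> intro a b h <;> simp [cupCapDiagram] at h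
  · intro v
    exact featureFree_of_length_le_one _ (by simp [cupCapDiagram])
  · intro a b h
    simpa [cupCapDiagram] using h.1

end Generators

noncomputable section GeneratingElements

variable {k : Type*} [Field k] (P : Parameters k)

instance (n : ℕ) : One (SymplecticBlobAlgebra P n) :=
  ⟨diagramBasis P ⟨identityDiagram n, verticalDiagram_isBasisDiagram n 0 [] rfl (by simp) (by simp)
    (by simp)⟩⟩

/-- The element `e` of `b_n`. -/
def e (n : ℕ) : SymplecticBlobAlgebra P n :=
  diagramBasis P ⟨eDiagram n, verticalDiagram_isBasisDiagram n 0 [Blob.L] rfl (by simp) (by simp)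
    (by simp)⟩

/-- The element `f` of `b_n`. -/
def f (n : ℕ) : SymplecticBlobAlgebra P n :=
  diagramBasis P ⟨fDiagram n, verticalDiagram_isBasisDiagram n (n - 1) [Blob.R] rfl (by simp) (by simp)
    (by simp)⟩

/-- The element `e_{i+1}` of `b_n`, for `0 ≤ i` and `i + 1 ≤ n - 1`. -/
def cupCap (n i : ℕ) (hi : i + 1 < n) : SymplecticBlobAlgebra P n :=
  diagramBasis P ⟨cupCapDiagram n i hi, cupCapDiagram_isBasisDiagram n i hi⟩

/-- The set `{e, e_1, …, e_{n-1}, f}`. -/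
def generators (n : ℕ) : Set (SymplecticBlobAlgebra P n) :=
  {e P n, f P n} ∪ {x | ∃ (i : ℕ) (hi : i + 1 < n), x = cupCap P n i hi}

end GeneratingElements

end SymplecticBlob

/-! The parameters play no role. Every diagram of `B_n` arises from the identity diagram by
successive multiplications, on the left or on the right, with generators, where each concatenation
has no loops and already lies in `B_n`. Such a product of basis elements is the resulting basis
element with coefficient 1 (`GluesTo.mul_eq`), so all basis elements lie in the generated
subalgebra.

What is reachable in this way is expressed by an arbitrary predicate closed under these
multiplications (`GeneratorClosed`). Such predicates can be composed with the top-bottom reflection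
`flip` and with the left-right reflection `mirror`, which exchanges the two blobs and also e and f.
Hence blobs need to be treated only when the first one met from a top vertex is a left blob.

Blobs are removed by induction on their number (`GeneratorClosed.of_head_left`). A left blob next to
the first top vertex is split off as a factor e. Suppose instead that it is next to the top vertex p
> 0, and that no earlier top vertex starts with a left blob. Then the line at p - 1 is undecorated
and cannot enclose p, so both its ends are on the top, to the left of p, and it encloses or is an
undecorated cup joining neighbours (`IsBasisDiagram.exists_hasCup`). Splitting off a factor e_{i+1}
slides a cup one place to the right, by straightening a zigzag (`gluesTo_moveCup`). Once the cup has
passed p, the blob is two places further to the left.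

An undecorated diagram other than the identity has cups on the top and on the bottom. Both are slid
to the right end; the diagram is then e_{n-1} times the diagram with two vertical lines in their
place, which has fewer non-propagating lines (`GeneratorClosed.of_two_cups_last`). -/

namespace SymplecticBlob

/-! ### Concatenations without loops, described by following lines. -/

section Trace

variable {n : ℕ}

/-- Following the lines of `D` from `x`, and jumping between `upperMid i` and `lowerMid i` for `i` in
`l`, one arrives at the outer vertex `u`, having read the word `w`. -/
inductive Trace (D : Decorated (Vertex n ⊕ Vertex n)) (l : List (Fin n)) :
    Vertex n ⊕ Vertex n → Vertex n → List Blob → Prop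
  | last (x : Vertex n ⊕ Vertex n) (u : Vertex n) : D.partner x = outer u → Trace D l x u (D.word x)
  | down (x : Vertex n ⊕ Vertex n) (i : Fin n) (u : Vertex n) (w : List Blob) : i ∈ l →
      D.partner x = upperMid i → Trace D l (lowerMid i) u w → Trace D l x u (D.word x ++ w)
  | up (x : Vertex n ⊕ Vertex n) (i : Fin n) (u : Vertex n) (w : List Blob) : i ∈ l →
      D.partner x = lowerMid i → Trace D l (upperMid i) u w → Trace D l x u (D.word x ++ w)

theorem outer_ne_upperMid (u : Vertex n) (i : Fin n) : outer u ≠ upperMid i := by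
  rcases u with u | u <;> simp [outer, upperMid]

theorem outer_ne_lowerMid (u : Vertex n) (i : Fin n) : outer u ≠ lowerMid i := by
  rcases u with u | u <;> simp [outer, lowerMid]

theorem upperMid_injective : Function.Injective (upperMid (n := n)) := by
  intro i j h
  simpa [upperMid] using h

theorem lowerMid_injective : Function.Injective (lowerMid (n := n)) := by
  intro i j h
  simpa [lowerMid] using h

/-- Joining two vertices shortens the traces, without changing where they end and the words. -/
theorem Trace.join {D : Decorated (Vertex n ⊕ Vertex n)} {i : Fin n} {l : List (Fin n)}
    (hi : i ∉ l) {x : Vertex n ⊕ Vertex n} {u : Vertex n} {w : List Blob}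
    (h : Trace D (i :: l) x u w) :
    (x ≠ upperMid i → x ≠ lowerMid i →
      Trace (D.join (upperMid i) (lowerMid i) (upperMid_ne_lowerMid i i)) l x u w) ∧
    (x = lowerMid i → ∀ y, y ≠ upperMid i → y ≠ lowerMid i → D.partner y = upperMid i →
      Trace (D.join (upperMid i) (lowerMid i) (upperMid_ne_lowerMid i i)) l y u (D.word y ++ w)) ∧
    (x = upperMid i → ∀ y, y ≠ upperMid i → y ≠ lowerMid i → D.partner y = lowerMid i →
      Trace (D.join (upperMid i) (lowerMid i) (upperMid_ne_lowerMid i i)) l y u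
        (D.word y ++ w)) := by
  have hpp := D.partner_partner
  have hne := D.partner_ne
  have hul := upperMid_ne_lowerMid i i
  set D' := D.join (upperMid i) (lowerMid i) (upperMid_ne_lowerMid i i) with hD'
  have same : ∀ y, y ≠ upperMid i → y ≠ lowerMid i → D.partner y ≠ upperMid i →
      D.partner y ≠ lowerMid i → D'.partner y = D.partner y ∧ D'.word y = D.word y := by
    intro y h1 h2 h3 h4
    simp only [hD', Decorated.join]
    grind
  have viaU : ∀ y, y ≠ upperMid i → y ≠ lowerMid i → D.partner y = upperMid i →
      D'.partner y = D.partner (lowerMid i) ∧ D'.word y = D.word y ++ D.word (lowerMid i) := by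
    intro y h1 h2 h3
    simp only [hD', Decorated.join]
    grind
  have viaL : ∀ y, y ≠ upperMid i → y ≠ lowerMid i → D.partner y = lowerMid i →
      D'.partner y = D.partner (upperMid i) ∧ D'.word y = D.word y ++ D.word (upperMid i) := by
    intro y h1 h2 h3
    simp only [hD', Decorated.join]
    grind
  -- The last two conjuncts serve a trace that passes through joint i: the line starting at y and
  -- ending at this joint absorbs the line behind it, so the jump disappears from the trace.
  induction h with
  | last x u hx =>
    have o1 := outer_ne_upperMid u i
    have o2 := outer_ne_lowerMid u i
    refine ⟨fun h1 h2 => ?_, fun h y h1 h2 h3 => ?_, fun h y h1 h2 h3 => ?_⟩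
    · obtain ⟨h3, h4⟩ := same x h1 h2 (hx ▸ o1) (hx ▸ o2)
      rw [← h4]
      exact .last _ _ (h3.trans hx)
    · subst h
      obtain ⟨h4, h5⟩ := viaU y h1 h2 h3
      rw [← h5]
      exact .last _ _ (h4.trans hx)
    · subst h
      obtain ⟨h4, h5⟩ := viaL y h1 h2 h3
      rw [← h5]
      exact .last _ _ (h4.trans hx)
  | down x j u w hj hx ht ih =>
    by_cases hji : j = i
    · subst hji
      refine ⟨fun h1 h2 => ih.2.1 rfl x h1 h2 hx, fun h y h1 h2 h3 => ?_, fun h y h1 h2 h3 => ?_⟩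
      · grind
      · grind
    · have hj' : j ∈ l := by simpa [hji] using hj
      have n1 : upperMid j ≠ upperMid i := fun h => hji (upperMid_injective h)
      have n2 : lowerMid j ≠ lowerMid i := fun h => hji (lowerMid_injective h)
      have n3 := upperMid_ne_lowerMid j i
      have n4 := (upperMid_ne_lowerMid i j).symm
      have ih' := ih.1 n4 n2
      refine ⟨fun h1 h2 => ?_, fun h y h1 h2 h3 => ?_, fun h y h1 h2 h3 => ?_⟩
      · obtain ⟨h3, h4⟩ := same x h1 h2 (hx ▸ n1) (hx ▸ n3)
        rw [← h4]
        exact .down _ j _ _ hj' (h3.trans hx) ih'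
      · subst h
        obtain ⟨h4, h5⟩ := viaU y h1 h2 h3
        rw [← List.append_assoc, ← h5]
        exact .down _ j _ _ hj' (h4.trans hx) ih'
      · subst h
        obtain ⟨h4, h5⟩ := viaL y h1 h2 h3
        rw [← List.append_assoc, ← h5]
        exact .down _ j _ _ hj' (h4.trans hx) ih'
  | up x j u w hj hx ht ih =>
    by_cases hji : j = i
    · subst hji
      refine ⟨fun h1 h2 => ih.2.2 rfl x h1 h2 hx, fun h y h1 h2 h3 => ?_, fun h y h1 h2 h3 => ?_⟩
      · grind
      · grind
    · have hj' : j ∈ l := by simpa [hji] using hj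
      have n1 : upperMid j ≠ upperMid i := fun h => hji (upperMid_injective h)
      have n2 : lowerMid j ≠ lowerMid i := fun h => hji (lowerMid_injective h)
      have n3 := upperMid_ne_lowerMid j i
      have n4 := (upperMid_ne_lowerMid i j).symm
      have ih' := ih.1 n1 n3
      refine ⟨fun h1 h2 => ?_, fun h y h1 h2 h3 => ?_, fun h y h1 h2 h3 => ?_⟩
      · obtain ⟨h3, h4⟩ := same x h1 h2 (hx ▸ n4) (hx ▸ n2)
        rw [← h4]
        exact .up _ j _ _ hj' (h3.trans hx) ih'
      · subst h
        obtain ⟨h4, h5⟩ := viaU y h1 h2 h3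
        rw [← List.append_assoc, ← h5]
        exact .up _ j _ _ hj' (h4.trans hx) ih'
      · subst h
        obtain ⟨h4, h5⟩ := viaL y h1 h2 h3
        rw [← List.append_assoc, ← h5]
        exact .up _ j _ _ hj' (h4.trans hx) ih'

/-- Otherwise the vertex lies on a loop: the trace would jump from the lower copy straight back to
its starting point, and a finite derivation cannot do so forever. -/
theorem Trace.partner_ne_lowerMid {D : Decorated (Vertex n ⊕ Vertex n)} {i : Fin n}
    {l : List (Fin n)} {x : Vertex n ⊕ Vertex n} {u : Vertex n} {w : List Blob}
    (h : Trace D l x u w) (hx : x = upperMid i) : D.partner (upperMid i) ≠ lowerMid i := by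
  induction h with
  | last x u hxu =>
    subst hx
    rw [hxu]
    exact outer_ne_lowerMid u i
  | down x j u w _ hxj _ _ =>
    subst hx
    rw [hxj]
    exact upperMid_ne_lowerMid j i
  | up x j u w _ hxj _ ih =>
    subst hx
    intro h
    exact ih (by rw [lowerMid_injective (hxj.symm.trans h)]) h

theorem Trace.of_nil {D : Decorated (Vertex n ⊕ Vertex n)} {x : Vertex n ⊕ Vertex n}
    {u : Vertex n} {w : List Blob} (h : Trace D [] x u w) :
    D.partner x = outer u ∧ D.word x = w := by
  cases h <;> simp_all

variable {k : Type*} [Field k] (P : Parameters k)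

/-- By `hmid` each joint still to be glued lies on an open line, so no step closes a loop and the
scalar never changes. By `Trace.join` each step removes one joint from the traces; a trace without
joints is a single line. -/
theorem trace_foldl (l : List (Fin n)) (hl : l.Nodup)
    (s : k × Decorated (Vertex n ⊕ Vertex n))
    (hmid : ∀ i ∈ l, ∃ u w, Trace s.2 l (upperMid i) u w) :
    (l.foldl (glueStep P) s).1 = s.1 ∧ ∀ x u w,
      (∀ i ∈ l, x ≠ upperMid i ∧ x ≠ lowerMid i) → Trace s.2 l x u w →
      (l.foldl (glueStep P) s).2.partner x = outer u ∧
      (l.foldl (glueStep P) s).2.word x = w := by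
  induction l generalizing s with
  | nil => exact ⟨rfl, fun x u w _ h => h.of_nil⟩
  | cons i l ih =>
    rw [List.nodup_cons] at hl
    have hloop : s.2.partner (upperMid i) ≠ lowerMid i := by
      obtain ⟨u, w, h⟩ := hmid i (by simp)
      exact h.partner_ne_lowerMid rfl
    obtain ⟨h1, h2⟩ := ih hl.2 (glueStep P s i) (by
      intro j hj
      obtain ⟨u, w, h⟩ := hmid j (by simp [hj])
      refine ⟨u, w, (h.join hl.1).1 ?_ (upperMid_ne_lowerMid j i)⟩
      intro hji
      rw [upperMid_injective hji] at hj
      exact hl.1 hj)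
    rw [List.foldl_cons]
    refine ⟨h1.trans (by simp [glueStep, hloop]), fun x u w hx h => ?_⟩
    exact h2 x u w (fun j hj => hx j (by simp [hj]))
      ((h.join hl.1).1 (hx i (by simp)).1 (hx i (by simp)).2)

/-- The concatenation of `d` (above) and `d'` (below) has no loops, and it is `r`. -/
structure GluesTo (d d' r : Diagram n) : Prop where
  outer : ∀ v, Trace (d.disjointUnion d') (List.finRange n) (outer v) (r.partner v) (r.word v)
  upper : ∀ i, ∃ u w, Trace (d.disjointUnion d') (List.finRange n) (upperMid i) u w
  lower : ∀ i, ∃ u w, Trace (d.disjointUnion d') (List.finRange n) (lowerMid i) u w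

theorem GluesTo.glue_fst {d d' r : Diagram n} (h : GluesTo d d' r) : (glue P d d').1 = 1 :=
  (trace_foldl P _ (List.nodup_finRange n) (1, d.disjointUnion d') (fun i _ => h.upper i)).1

theorem GluesTo.concat_eq {d d' r : Diagram n} (h : GluesTo d d' r) : concat P d d' = r := by
  have key := fun v => (trace_foldl P _ (List.nodup_finRange n) (1, d.disjointUnion d')
    (fun i _ => h.upper i)).2 (SymplecticBlob.outer v) _ _
    (fun i _ => ⟨outer_ne_upperMid v i, outer_ne_lowerMid v i⟩) (h.outer v)
  ext1
  · funext v
    change outerPart ((glue P d d').2.partner _) = _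
    rw [glue, (key v).1, outerPart_outer]
  · funext v
    exact (key v).2

/-- Without repetitions the two letters alternate, and an alternating word of length three or more
begins with a forbidden xyx. -/
theorem FeatureFree.eq {w : List Blob} (hw : FeatureFree w) :
    w = [] ∨ w = [Blob.L] ∨ w = [Blob.R] ∨ w = [Blob.L, Blob.R] ∨ w = [Blob.R, Blob.L] := by
  have h2 : ∀ x w', w ≠ x :: x :: w' := fun x w' h => (hw x x).1 ⟨[], w', by simp [h]⟩
  have h3 : ∀ x y w', w ≠ x :: y :: x :: w' := fun x y w' h => (hw x y).2 ⟨[], w', by simp [h]⟩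
  have h4 : ∀ x y w', w ≠ x :: y :: y :: w' := fun x y w' h => (hw y y).1 ⟨[x], w', by simp [h]⟩
  rcases w with _ | ⟨x, _ | ⟨y, _ | ⟨z, w⟩⟩⟩
  · simp
  · cases x <;> simp
  · have := h2 x []
    cases x <;> cases y <;> simp_all
  · have := h2 x (z :: w)
    have := h3 x y w
    have := h4 x y w
    cases x <;> cases y <;> cases z <;> simp_all

theorem FeatureFree.straighten {w : List Blob} (hw : FeatureFree w) :
    P.straighten w = (1, w) := by
  rcases hw.eq with rfl | rfl | rfl | rfl | rfl <;>
    simp [Parameters.straighten, Parameters.straightenCons]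

/-- A concatenation without loops that gives a diagram of `B_n` is the product. -/
theorem GluesTo.mul_eq {d d' r : BasisDiagram n} (h : GluesTo d.1 d'.1 r.1) :
    diagramBasis P d * diagramBasis P d' = diagramBasis P r := by
  -- Since `r` is already in `B_n`, its words are straight with scalar 1 and the topological
  -- relation does not apply to it.
  have hw := fun v => (r.2.1.featureFree v).straighten P
  have h1 : Diagram.straightenScalar P r.1 = 1 :=
    Finset.prod_eq_one fun v _ => by rw [hw]
  have h2 : Decorated.straightenWords P r.1 = r.1 := by
    ext1
    · rfl
    · funext v
      simp only [Decorated.straightenWords, hw]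
  have h3 : ¬ ∃ p : Fin n × Fin n, Diagram.TopBottomLR r.1 p.1 p.2 :=
    fun ⟨p, hp⟩ => r.2.2 p.1 p.2 hp
  rw [basis_mul_basis, basisMul, h.glue_fst, h.concat_eq, h1, h2, topological, dif_neg h3,
    ofDiagram, dif_pos r.2]
  simp

end Trace

end SymplecticBlob

namespace SymplecticBlob

/-! ### The two reflections preserve the set of basis diagrams. -/

section Symmetry

variable {n : ℕ}

/-- Exchange the left and the right blob. -/
def Blob.swap : Blob → Blob
  | Blob.L => Blob.R
  | Blob.R => Blob.L

theorem Blob.swap_swap (x : Blob) : x.swap.swap = x := by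
  cases x <;> rfl

/-- Rename the vertices by `σ` and the blobs by `β`. -/
def Decorated.relabel {V W : Type} (σ : V ≃ W) (β : Blob → Blob) (d : Decorated V) :
    Decorated W where
  partner w := σ (d.partner (σ.symm w))
  word w := (d.word (σ.symm w)).map β
  partner_partner w := by simp [d.partner_partner]
  partner_ne w h := d.partner_ne (σ.symm w) (by rw [Equiv.eq_symm_apply, h])
  word_partner w := by simp [d.word_partner]

@[simp]
theorem Decorated.relabel_partner {V W : Type} (σ : V ≃ W) (β : Blob → Blob) (d : Decorated V)
    (v : V) : (d.relabel σ β).partner (σ v) = σ (d.partner v) := by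
  simp [Decorated.relabel]

@[simp]
theorem Decorated.relabel_word {V W : Type} (σ : V ≃ W) (β : Blob → Blob) (d : Decorated V)
    (v : V) : (d.relabel σ β).word (σ v) = (d.word v).map β := by
  simp [Decorated.relabel]

/-- Exchange the top edge and the bottom edge. -/
def flip (d : Diagram n) : Diagram n := d.relabel (Equiv.sumComm _ _) id

/-- The reflection of the vertices that exchanges the left edge and the right edge. -/
def mirrorVertex : Vertex n ≃ Vertex n := Equiv.sumCongr Fin.revPerm Fin.revPerm

/-- Exchange the left edge and the right edge, and the left and the right blobs. -/
def mirror (d : Diagram n) : Diagram n := d.relabel mirrorVertex Blob.swap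

theorem flip_partner (d : Diagram n) (v : Vertex n) :
    (flip d).partner v.swap = (d.partner v).swap :=
  d.relabel_partner (Equiv.sumComm _ _) id v

theorem flip_word (d : Diagram n) (v : Vertex n) : (flip d).word v.swap = d.word v := by
  exact (d.relabel_word (Equiv.sumComm _ _) id v).trans (List.map_id _)

theorem mirror_partner (d : Diagram n) (v : Vertex n) :
    (mirror d).partner (mirrorVertex v) = mirrorVertex (d.partner v) :=
  d.relabel_partner _ _ v

theorem mirror_word (d : Diagram n) (v : Vertex n) :
    (mirror d).word (mirrorVertex v) = (d.word v).map Blob.swap :=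
  d.relabel_word _ _ v

theorem flip_flip (d : Diagram n) : flip (flip d) = d := by
  ext1 <;> funext v <;> simp [flip, Decorated.relabel]

theorem mirrorVertex_mirrorVertex (v : Vertex n) : mirrorVertex (mirrorVertex v) = v := by
  rcases v with v | v <;> simp [mirrorVertex]

theorem mirrorVertex_symm (v : Vertex n) : mirrorVertex.symm v = mirrorVertex v := by
  rw [Equiv.symm_apply_eq, mirrorVertex_mirrorVertex]

theorem mirror_mirror (d : Diagram n) : mirror (mirror d) = d := by
  ext1 <;> funext v
  · simp [mirror, Decorated.relabel, mirrorVertex_symm, mirrorVertex_mirrorVertex]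
  · simp only [mirror, Decorated.relabel, mirrorVertex_symm, mirrorVertex_mirrorVertex,
      List.map_map]
    rw [show Blob.swap ∘ Blob.swap = id from funext Blob.swap_swap, List.map_id]

theorem pos_lt (v : Vertex n) : pos v < 2 * n := by
  rcases v with v | v <;> simp only [pos] <;> omega

theorem pos_injective : Function.Injective (pos (n := n)) := by
  rintro (u | u) (v | v) h <;> simp only [pos] at h <;> simp [Fin.ext_iff] <;> omega

theorem pos_swap (v : Vertex n) : pos v.swap + pos v + 1 = 2 * n := by
  rcases v with v | v <;> simp only [pos, Sum.swap_inl, Sum.swap_inr] <;> omega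

/-- The reflection is p ↦ n - 1 - p modulo 2n. It reverses the cyclic order of the frame, but the
linear order only within each edge, because positions are counted from the left edge. -/
theorem pos_mirrorVertex (v : Vertex n) :
    pos v < n ∧ pos (mirrorVertex v) + pos v + 1 = n ∨
    n ≤ pos v ∧ pos (mirrorVertex v) + pos v + 1 = 3 * n := by
  rcases v with v | v <;> simp [pos, mirrorVertex, Fin.val_rev] <;> omega

theorem exists_swap (v : Vertex n) : ∃ u : Vertex n, u.swap = v := ⟨v.swap, by simp⟩

theorem exists_mirrorVertex (v : Vertex n) : ∃ u : Vertex n, mirrorVertex u = v :=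
  mirrorVertex.surjective v

/-- Positions are reversed, p ↦ 2n - 1 - p, so each line keeps its inside and only its two endpoints
exchange their roles. -/
theorem IsBasisDiagram.flip {d : Diagram n} (hd : IsBasisDiagram d) :
    IsBasisDiagram (flip d) := by
  obtain ⟨⟨h1, h2, h3, h4, h5⟩, h6⟩ := hd
  refine ⟨⟨?_, ?_, ?_, ?_, ?_⟩, ?_⟩
  · intro u v
    obtain ⟨u, rfl⟩ := exists_swap u
    obtain ⟨v, rfl⟩ := exists_swap v
    have a := h1 (d.partner u) v
    have a' := h1 (d.partner u) (d.partner v)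
    simp only [Diagram.Inside, flip_partner, d.partner_partner] at *
    have := pos_swap u
    have := pos_swap v
    have := pos_swap (d.partner u)
    have := pos_swap (d.partner v)
    omega
  · intro v hv u
    obtain ⟨u, rfl⟩ := exists_swap u
    obtain ⟨v, rfl⟩ := exists_swap v
    rw [flip_word] at hv
    have a := h2 v hv (d.partner u)
    simp only [Diagram.Inside, flip_partner, d.partner_partner] at *
    have := pos_swap u
    have := pos_swap v
    have := pos_swap (d.partner u)
    omega
  · intro v hv u
    obtain ⟨u, rfl⟩ := exists_swap u
    obtain ⟨v, rfl⟩ := exists_swap v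
    rw [flip_word] at hv
    intro b1 b2 b3
    have a := h3 v hv (d.partner u)
    simp only [flip_partner] at b1 b3
    have b2' : u ≠ v := fun h => b2 (by rw [h])
    have b3' : d.partner u ≠ v := fun h => b3 (by rw [h])
    have c1 := pos_swap u
    have c2 := pos_swap v
    have c3 := pos_swap (d.partner u)
    rw [d.partner_partner] at a
    specialize a (by omega) b3' b2'
    simp only [Diagram.Inside, flip_partner, d.partner_partner] at *
    omega
  · refine ⟨fun i j hi hj => ?_, fun i j hi hj => ?_⟩
    · exact h4.2 i j (by rw [← hi, ← flip_word]; rfl) (by rw [← hj, ← flip_word]; rfl)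
    · exact h4.1 i j (by rw [← hi, ← flip_word]; rfl) (by rw [← hj, ← flip_word]; rfl)
  · intro v
    obtain ⟨v, rfl⟩ := exists_swap v
    rw [flip_word]
    exact h5 v
  · intro i j ⟨a1, a2, a3, a4⟩
    refine h6 j i ⟨?_, ?_, ?_, ?_⟩
    · rw [← a3, ← flip_word]; rfl
    · rw [show (Sum.inr j : Vertex n) = (Sum.inl j : Vertex n).swap from rfl, flip_partner] at a4
      simpa using a4
    · rw [← a1, ← flip_word]; rfl
    · rw [show (Sum.inl i : Vertex n) = (Sum.inr i : Vertex n).swap from rfl, flip_partner] at a2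
      simpa using a2

theorem head?_map_swap (w : List Blob) (x : Blob) :
    (w.map Blob.swap).head? = some x ↔ w.head? = some x.swap := by
  rcases w with _ | ⟨y, w⟩
  · simp
  · cases x <;> cases y <;> simp [Blob.swap]

theorem map_swap_featureFree {w : List Blob} (hw : FeatureFree w) :
    FeatureFree (w.map Blob.swap) := by
  intro x y
  have h : (w.map Blob.swap).map Blob.swap = w := by
    rw [List.map_map, show Blob.swap ∘ Blob.swap = id from funext Blob.swap_swap, List.map_id]
  constructor <;> intro hx <;> have := hx.map Blob.swap <;> rw [h] at this
  · exact (hw x.swap y).1 this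
  · exact (hw x.swap y.swap).2 this

theorem mem_map_swap (w : List Blob) (x : Blob) :
    x ∈ w.map Blob.swap ↔ x.swap ∈ w := by
  rw [List.mem_map]
  constructor
  · rintro ⟨y, hy, rfl⟩
    rwa [Blob.swap_swap]
  · intro h
    exact ⟨_, h, Blob.swap_swap x⟩

/-- Crossing is a cyclic notion, although `Inside` depends on the cut at the left edge; the
noncrossing condition for all choices of endpoints of the two lines therefore gives the mirrored
one. Exposure to the left edge and exposure to the right edge are exchanged. -/
theorem IsBasisDiagram.mirror {d : Diagram n} (hd : IsBasisDiagram d) :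
    IsBasisDiagram (mirror d) := by
  obtain ⟨⟨h1, h2, h3, h4, h5⟩, h6⟩ := hd
  have hl : ∀ i : Fin n, (Sum.inl i : Vertex n) = mirrorVertex (Sum.inl i.rev) := by
    intro i
    simp [mirrorVertex]
  have hr : ∀ i : Fin n, (Sum.inr i : Vertex n) = mirrorVertex (Sum.inr i.rev) := by
    intro i
    simp [mirrorVertex]
  refine ⟨⟨?_, ?_, ?_, ?_, ?_⟩, ?_⟩
  · intro u v
    obtain ⟨u, rfl⟩ := exists_mirrorVertex u
    obtain ⟨v, rfl⟩ := exists_mirrorVertex v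
    have a1 := h1 u v
    have a2 := h1 u (d.partner v)
    have a3 := h1 (d.partner u) v
    have a4 := h1 (d.partner u) (d.partner v)
    have i1 := @pos_injective n u v
    have i2 := @pos_injective n u (d.partner v)
    have i3 := @pos_injective n (d.partner u) v
    simp only [Diagram.Inside, mirror_partner, d.partner_partner] at *
    have := pos_lt u
    have := pos_lt v
    have := pos_lt (d.partner u)
    have := pos_lt (d.partner v)
    rcases eq_or_ne u v with rfl | huv
    · omega
    rcases eq_or_ne u (d.partner v) with rfl | huv'
    · rw [d.partner_partner]; omega
    have huv'' : pos (d.partner u) ≠ pos v := by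
      intro h
      apply huv'
      rw [← i3 h, d.partner_partner]
    have huv3 : pos (d.partner u) ≠ pos (d.partner v) := by
      intro h
      apply huv
      rw [← d.partner_partner u, pos_injective h, d.partner_partner]
    have huv4 : pos u ≠ pos v := fun h => huv (i1 h)
    have huv5 : pos u ≠ pos (d.partner v) := fun h => huv' (i2 h)
    clear i1 i2 i3
    rcases pos_mirrorVertex u with b1 | b1 <;> rcases pos_mirrorVertex v with b2 | b2 <;>
    rcases pos_mirrorVertex (d.partner u) with b3 | b3 <;>
    rcases pos_mirrorVertex (d.partner v) with b4 | b4 <;> omega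
  · intro v hv u
    obtain ⟨u, rfl⟩ := exists_mirrorVertex u
    obtain ⟨v, rfl⟩ := exists_mirrorVertex v
    rw [mirror_word, mem_map_swap] at hv
    have a := h3 v hv u
    have a' := h3 v hv (d.partner u)
    simp only [Diagram.Inside, mirror_partner, d.partner_partner] at *
    rcases eq_or_ne u v with rfl | huv
    · omega
    rcases eq_or_ne (d.partner u) v with rfl | huv'
    · omega
    have := d.partner_ne u
    have i1 : pos (d.partner u) ≠ pos u := fun h => d.partner_ne u (pos_injective h)
    have i2 : pos u ≠ pos v := fun h => huv (pos_injective h)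
    have i3 : pos (d.partner u) ≠ pos v := fun h => huv' (pos_injective h)
    have a1 : pos u < pos (d.partner u) → _ := fun h => (a h huv huv').1
    have a2 : pos u < pos (d.partner u) → _ := fun h => (a h huv huv').2
    have a3 : pos (d.partner u) < pos u → _ := fun h => (a' h huv' huv).1
    have a4 : pos (d.partner u) < pos u → _ := fun h => (a' h huv' huv).2
    clear a a'
    have := pos_lt u
    have := pos_lt v
    have := pos_lt (d.partner u)
    rcases pos_mirrorVertex u with b1 | b1 <;> rcases pos_mirrorVertex v with b2 | b2 <;>
    rcases pos_mirrorVertex (d.partner u) with b3 | b3 <;> omega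
  · intro v hv u
    obtain ⟨u, rfl⟩ := exists_mirrorVertex u
    obtain ⟨v, rfl⟩ := exists_mirrorVertex v
    rw [mirror_word, mem_map_swap] at hv
    have a := h2 v hv u
    have a' := h2 v hv (d.partner u)
    simp only [Diagram.Inside, mirror_partner, d.partner_partner] at *
    intro c1 c2 c3
    have huv : u ≠ v := fun h => c2 (by rw [h])
    have huv' : d.partner u ≠ v := fun h => c3 (by rw [h])
    have i2 : pos u ≠ pos v := fun h => huv (pos_injective h)
    have i3 : pos (d.partner u) ≠ pos v := fun h => huv' (pos_injective h)
    have := pos_lt u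
    have := pos_lt v
    have := pos_lt (d.partner u)
    rcases pos_mirrorVertex u with b1 | b1 <;> rcases pos_mirrorVertex v with b2 | b2 <;>
    rcases pos_mirrorVertex (d.partner u) with b3 | b3 <;> omega
  · refine ⟨fun i j hi hj => ?_, fun i j hi hj => ?_⟩
    · rw [hl, mirror_word, head?_map_swap] at hi hj
      exact Fin.rev_lt_rev.1 (h4.1 _ _ hj hi)
    · rw [hr, mirror_word, head?_map_swap] at hi hj
      exact Fin.rev_lt_rev.1 (h4.2 _ _ hj hi)
  · intro v
    obtain ⟨v, rfl⟩ := exists_mirrorVertex v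
    rw [mirror_word]
    exact map_swap_featureFree (h5 v)
  · intro i j ⟨a1, a2, a3, a4⟩
    -- A mirrored word `[L, R]` comes from `[R, L]`, so in `d` the endpoint next to the left blob is
    -- the other end of the line.
    have hw : ∀ v, (d.word v).map Blob.swap = [Blob.L, Blob.R] →
        d.word (d.partner v) = [Blob.L, Blob.R] := by
      intro v
      rw [d.word_partner]
      rcases (h5 v).eq with h | h | h | h | h <;> rw [h] <;> simp [Blob.swap]
    rw [hl, mirror_partner] at a2
    rw [hr, mirror_partner] at a4
    rw [hl, mirror_word] at a1
    rw [hr, mirror_word] at a3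
    rcases b1 : d.partner (Sum.inl i.rev) with i' | i'
    · rcases b2 : d.partner (Sum.inr j.rev) with j' | j'
      · simp [b2, mirrorVertex] at a4
      · refine h6 i' j' ⟨?_, ?_, ?_, ?_⟩
        · rw [← b1, hw _ a1]
        · rw [← b1, d.partner_partner]; rfl
        · rw [← b2, hw _ a3]
        · rw [← b2, d.partner_partner]; rfl
    · simp [b1, mirrorVertex] at a2

end Symmetry

/-! ### Loop-free concatenation is compatible with the reflections. -/

section SymmetryOfGluing

variable {n : ℕ}

/-- The action of `flip` on the vertices of two diagrams, one above the other. -/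
def flipBoth (x : Vertex n ⊕ Vertex n) : Vertex n ⊕ Vertex n :=
  (Sum.map Sum.swap Sum.swap x).swap

/-- The reflection exchanges the two factors, hence also the downward and upward jumps. Traces do
not depend on the order in which joints are glued, which makes such symmetries visible. -/
theorem Trace.flip {d d' : Diagram n} {x : Vertex n ⊕ Vertex n} {u : Vertex n} {w : List Blob}
    (h : Trace (d.disjointUnion d') (List.finRange n) x u w) :
    Trace ((flip d').disjointUnion (flip d)) (List.finRange n) (flipBoth x) u.swap w := by
  have hp : ∀ x, ((SymplecticBlob.flip d').disjointUnion (SymplecticBlob.flip d)).partner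
      (flipBoth x) = flipBoth ((d.disjointUnion d').partner x) := by
    rintro (x | x) <;> simp [flipBoth, Decorated.disjointUnion, flip_partner]
  have hw : ∀ x, ((SymplecticBlob.flip d').disjointUnion (SymplecticBlob.flip d)).word
      (flipBoth x) = (d.disjointUnion d').word x := by
    rintro (x | x) <;> simp [flipBoth, Decorated.disjointUnion, flip_word]
  induction h with
  | last x u hx =>
    rw [← hw]
    refine .last _ _ ?_
    rw [hp, hx]
    rcases u with u | u <;> rfl
  | down x i u w hi hx _ ih =>
    rw [← hw]
    exact .up _ i _ _ hi (by rw [hp, hx]; rfl) ih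
  | up x i u w hi hx _ ih =>
    rw [← hw]
    exact .down _ i _ _ hi (by rw [hp, hx]; rfl) ih

theorem GluesTo.flip {d d' r : Diagram n} (h : GluesTo d d' r) :
    GluesTo (flip d') (flip d) (flip r) := by
  refine ⟨fun v => ?_, fun i => ?_, fun i => ?_⟩
  · obtain ⟨v, rfl⟩ := exists_swap v
    rw [flip_partner, flip_word]
    have := (h.outer v).flip
    rcases v with v | v <;> exact this
  · obtain ⟨u, w, hu⟩ := h.lower i
    exact ⟨_, _, hu.flip⟩
  · obtain ⟨u, w, hu⟩ := h.upper i
    exact ⟨_, _, hu.flip⟩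

theorem Trace.mirror {d d' : Diagram n} {x : Vertex n ⊕ Vertex n} {u : Vertex n} {w : List Blob}
    (h : Trace (d.disjointUnion d') (List.finRange n) x u w) :
    Trace ((mirror d).disjointUnion (mirror d')) (List.finRange n)
      (Sum.map mirrorVertex mirrorVertex x) (mirrorVertex u) (w.map Blob.swap) := by
  have hp : ∀ x, ((SymplecticBlob.mirror d).disjointUnion (SymplecticBlob.mirror d')).partner
      (Sum.map mirrorVertex mirrorVertex x) =
        Sum.map mirrorVertex mirrorVertex ((d.disjointUnion d').partner x) := by
    rintro (x | x) <;> simp [Decorated.disjointUnion, mirror_partner]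
  have hw : ∀ x, ((SymplecticBlob.mirror d).disjointUnion (SymplecticBlob.mirror d')).word
      (Sum.map mirrorVertex mirrorVertex x) = ((d.disjointUnion d').word x).map Blob.swap := by
    rintro (x | x) <;> simp [Decorated.disjointUnion, mirror_word]
  induction h with
  | last x u hx =>
    rw [← hw]
    refine .last _ _ ?_
    rw [hp, hx]
    rcases u with u | u <;> rfl
  | down x i u w hi hx _ ih =>
    rw [List.map_append, ← hw]
    exact .down _ i.rev _ _ (List.mem_finRange _) (by rw [hp, hx]; rfl) ih
  | up x i u w hi hx _ ih =>
    rw [List.map_append, ← hw]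
    exact .up _ i.rev _ _ (List.mem_finRange _) (by rw [hp, hx]; rfl) ih

theorem GluesTo.mirror {d d' r : Diagram n} (h : GluesTo d d' r) :
    GluesTo (mirror d) (mirror d') (mirror r) := by
  refine ⟨fun v => ?_, fun i => ?_, fun i => ?_⟩
  · obtain ⟨v, rfl⟩ := exists_mirrorVertex v
    rw [mirror_partner, mirror_word]
    have := (h.outer v).mirror
    rcases v with v | v <;> exact this
  · obtain ⟨u, w, hu⟩ := h.upper i.rev
    have := hu.mirror
    rw [show Sum.map mirrorVertex mirrorVertex (upperMid i.rev) = upperMid i by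
      simp [upperMid, mirrorVertex]] at this
    exact ⟨_, _, this⟩
  · obtain ⟨u, w, hu⟩ := h.lower i.rev
    have := hu.mirror
    rw [show Sum.map mirrorVertex mirrorVertex (lowerMid i.rev) = lowerMid i by
      simp [lowerMid, mirrorVertex]] at this
    exact ⟨_, _, this⟩

end SymmetryOfGluing

/-! ### Predicates inherited by scalar-free products with generators. -/

section ClosedPredicates

variable {n : ℕ}

/-- The diagrams `e`, `f` and `e_1, …, e_{n-1}`. -/
def IsGenerator (g : Diagram n) : Prop :=
  g = eDiagram n ∨ g = fDiagram n ∨ ∃ i hi, g = cupCapDiagram n i hi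

theorem flip_verticalDiagram (m : ℕ) (w : List Blob) (hw : w.reverse = w) :
    flip (verticalDiagram n m w hw) = verticalDiagram n m w hw := by
  ext1 <;> funext v <;> rcases v with v | v <;> simp [flip, Decorated.relabel, verticalDiagram]

theorem mirror_eDiagram : mirror (eDiagram n) = fDiagram n := by
  ext1 <;> funext v
  · rcases v with v | v <;> simp [mirror, Decorated.relabel, eDiagram, fDiagram, verticalDiagram,
      mirrorVertex_symm] <;> simp [mirrorVertex]
  · rcases v with v | v <;> simp [mirror, Decorated.relabel, eDiagram, fDiagram, verticalDiagram,
      mirrorVertex_symm] <;> simp [mirrorVertex, Fin.val_rev, apply_ite (List.map Blob.swap),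
      Blob.swap] <;> grind

theorem flip_cupCapDiagram (i : ℕ) (hi : i + 1 < n) :
    flip (cupCapDiagram n i hi) = cupCapDiagram n i hi := by
  ext1 <;> funext v
  · rcases v with v | v <;> simp [flip, Decorated.relabel, cupCapDiagram] <;> split_ifs <;> rfl
  · rcases v with v | v <;> simp [flip, Decorated.relabel, cupCapDiagram]

theorem mirror_cupCapDiagram (i : ℕ) (hi : i + 1 < n) :
    mirror (cupCapDiagram n i hi) = cupCapDiagram n (n - 2 - i) (by omega) := by
  ext1 <;> funext v
  · rcases v with v | v <;> simp [mirror, Decorated.relabel, cupCapDiagram, mirrorVertex_symm] <;>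
      simp only [mirrorVertex, Equiv.sumCongr_apply, Sum.map_inl, Sum.map_inr,
        Fin.revPerm_apply, Fin.val_rev] <;> split_ifs <;>
      simp [Fin.ext_iff, Fin.val_rev] <;> omega
  · rcases v with v | v <;> simp [mirror, Decorated.relabel, cupCapDiagram]

theorem IsGenerator.flip {g : Diagram n} (hg : IsGenerator g) : IsGenerator (flip g) := by
  rcases hg with rfl | rfl | ⟨i, hi, rfl⟩
  · exact Or.inl (flip_verticalDiagram _ _ _)
  · exact Or.inr (Or.inl (flip_verticalDiagram _ _ _))
  · exact Or.inr (Or.inr ⟨i, hi, flip_cupCapDiagram i hi⟩)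

theorem IsGenerator.mirror {g : Diagram n} (hg : IsGenerator g) : IsGenerator (mirror g) := by
  rcases hg with rfl | rfl | ⟨i, hi, rfl⟩
  · exact Or.inr (Or.inl mirror_eDiagram)
  · exact Or.inl (by rw [← mirror_eDiagram, mirror_mirror])
  · exact Or.inr (Or.inr ⟨_, _, mirror_cupCapDiagram i hi⟩)

/-- The predicate `G` holds for the identity diagram, and it is inherited by the products with a
generator that are diagrams of `B_n` with coefficient `1`. -/
structure GeneratorClosed (G : Diagram n → Prop) : Prop where
  one : G (identityDiagram n)
  mul_left : ∀ g d r, IsGenerator g → IsBasisDiagram d → IsBasisDiagram r → GluesTo g d r →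
    G d → G r
  mul_right : ∀ g d r, IsGenerator g → IsBasisDiagram d → IsBasisDiagram r → GluesTo d g r →
    G d → G r

/-- Flipping reverses the order of the factors; this is why closure is required under multiplication
on both sides. -/
theorem GeneratorClosed.comp_flip {G : Diagram n → Prop} (hG : GeneratorClosed G) :
    GeneratorClosed fun d => G (flip d) where
  one := by
    have h : SymplecticBlob.flip (identityDiagram n) = identityDiagram n :=
      flip_verticalDiagram _ _ _
    rw [h]
    exact hG.one
  mul_left g d r hg hd hr h := hG.mul_right _ _ _ hg.flip hd.flip hr.flip h.flip
  mul_right g d r hg hd hr h := hG.mul_left _ _ _ hg.flip hd.flip hr.flip h.flip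

theorem mirror_identityDiagram : mirror (identityDiagram n) = identityDiagram n := by
  ext1 <;> funext v <;> rcases v with v | v <;>
    simp [mirror, Decorated.relabel, identityDiagram, verticalDiagram, mirrorVertex_symm] <;>
    simp [mirrorVertex]

/-- For general parameters the reflection should not be expected to respect products in the algebra,
since it exchanges the roles of δ_L and δ_R. Only scalar-free products are considered here, and
those it does respect. -/
theorem GeneratorClosed.comp_mirror {G : Diagram n → Prop} (hG : GeneratorClosed G) :
    GeneratorClosed fun d => G (mirror d) where
  one := by
    rw [mirror_identityDiagram]
    exact hG.one
  mul_left g d r hg hd hr h := hG.mul_left _ _ _ hg.mirror hd.mirror hr.mirror h.mirror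
  mul_right g d r hg hd hr h := hG.mul_right _ _ _ hg.mirror hd.mirror hr.mirror h.mirror

end ClosedPredicates

end SymplecticBlob

namespace SymplecticBlob

/-! ### Left multiplication by e_{i+1} and by e. -/

section Products

variable {n : ℕ}

/-- The product of `e_{i+1}` and a diagram in which the line at the top vertex `i` does not end at the
top vertex `i + 1`. -/
theorem gluesTo_cupCapDiagram (d : Diagram n) (i : ℕ) (hi : i + 1 < n) (a b : Vertex n)
    (ha : a = Sum.inl ⟨i, Nat.lt_of_succ_lt hi⟩) (hb : b = Sum.inl ⟨i + 1, hi⟩) (hab : a ≠ b)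
    (hloop : d.partner a ≠ b) : GluesTo (cupCapDiagram n i hi) d (d.join a b hab) := by
  -- The dummy undecorated pair that `join` leaves at `a` and `b` is exactly the top line of
  -- e_{i+1}; its bottom line connects the lines of `d` that end there.
  set D := (cupCapDiagram n i hi).disjointUnion d with hD
  have hpp := d.partner_partner
  have hloop' : d.partner b ≠ a := fun h => hloop (by rw [← h, hpp])
  have memf : ∀ j : Fin n, j ∈ List.finRange n := List.mem_finRange
  have pr : ∀ v, D.partner (Sum.inr v) = Sum.inr (d.partner v) := fun v => rfl
  have wr : ∀ v, D.word (Sum.inr v) = d.word v := fun v => rfl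
  have wl : ∀ v, D.word (Sum.inl v) = [] := fun v => rfl
  have throughU : ∀ j : Fin n, j.val ≠ i → j.val ≠ i + 1 →
      D.partner (upperMid j) = outer (Sum.inl j) := by
    intro j h1 h2
    simp [hD, Decorated.disjointUnion, cupCapDiagram, upperMid, outer, h1, h2]
  have throughO : ∀ j : Fin n, j.val ≠ i → j.val ≠ i + 1 →
      D.partner (outer (Sum.inl j)) = upperMid j := by
    intro j h1 h2
    simp [hD, Decorated.disjointUnion, cupCapDiagram, upperMid, outer, h1, h2]
  have uU : D.partner (upperMid ⟨i, Nat.lt_of_succ_lt hi⟩) = upperMid ⟨i + 1, hi⟩ := by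
    simp [hD, Decorated.disjointUnion, cupCapDiagram, upperMid]
  have uU' : D.partner (upperMid ⟨i + 1, hi⟩) = upperMid ⟨i, Nat.lt_of_succ_lt hi⟩ := by
    simp [hD, Decorated.disjointUnion, cupCapDiagram, upperMid]
  have oO : D.partner (outer a) = outer b := by
    simp [hD, Decorated.disjointUnion, cupCapDiagram, outer, ha, hb]
  have oO' : D.partner (outer b) = outer a := by
    simp [hD, Decorated.disjointUnion, cupCapDiagram, outer, ha, hb]
  have ne_of : ∀ j : Fin n, (Sum.inl j : Vertex n) ≠ a → (Sum.inl j : Vertex n) ≠ b →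
      j.val ≠ i ∧ j.val ≠ i + 1 := by
    intro j h1 h2
    constructor <;> intro h
    · exact h1 (by rw [ha, Sum.inl.injEq, Fin.ext_iff]; exact h)
    · exact h2 (by rw [hb, Sum.inl.injEq, Fin.ext_iff]; exact h)
  have arrive : ∀ v z, d.partner v = z → z ≠ a → z ≠ b →
      Trace D (List.finRange n) (Sum.inr v) z (d.word v) := by
    intro v z hv h1 h2
    rcases z with j | j
    · obtain ⟨h3, h4⟩ := ne_of j h1 h2
      have := Trace.up (D := D) (Sum.inr v) j (Sum.inl j) _ (memf j) (by rw [pr, hv]; rfl)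
        (.last _ _ (throughU j h3 h4))
      simpa [wr, wl, upperMid] using this
    · have := Trace.last (D := D) (l := List.finRange n) (Sum.inr v) (Sum.inr j)
        (by rw [pr, hv]; rfl)
      simpa [wr] using this
  -- Here the trace runs along the bottom line of e_{i+1} to its other end and then along the line
  -- of `d` at `b`.
  have arriveU : ∀ z, d.partner b = z → z ≠ b →
      Trace D (List.finRange n) (upperMid ⟨i, Nat.lt_of_succ_lt hi⟩) z (d.word b) := by
    intro z hz h
    have := Trace.down (D := D) (upperMid ⟨i, Nat.lt_of_succ_lt hi⟩) ⟨i + 1, hi⟩ z _ (memf _) uU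
      (by
        have := arrive b z hz (by rw [← hz]; exact hloop') h
        rw [hb] at this
        exact this)
    simpa [wl, upperMid, ← hb] using this
  have arriveU' : ∀ z, d.partner a = z → z ≠ a →
      Trace D (List.finRange n) (upperMid ⟨i + 1, hi⟩) z (d.word a) := by
    intro z hz h
    have := Trace.down (D := D) (upperMid ⟨i + 1, hi⟩) ⟨i, Nat.lt_of_succ_lt hi⟩ z _ (memf _) uU'
      (by
        have := arrive a z hz h (by rw [← hz]; exact hloop)
        rw [ha] at this
        exact this)
    simpa [wl, upperMid, ← ha] using this
  have start : ∀ v z w, v ≠ a → v ≠ b → Trace D (List.finRange n) (Sum.inr v) z w →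
      Trace D (List.finRange n) (outer v) z w := by
    intro v z w h1 h2 h
    rcases v with j | j
    · obtain ⟨h3, h4⟩ := ne_of j h1 h2
      exact Trace.down (D := D) (outer (Sum.inl j)) j z w (memf j) (throughO j h3 h4) h
    · exact h
  have ends : ∀ v, v ≠ a → v ≠ b →
      Trace D (List.finRange n) (Sum.inr v) ((d.join a b hab).partner v)
        ((d.join a b hab).word v) := by
    intro v h1 h2
    simp only [Decorated.join, if_neg h1, if_neg h2]
    by_cases h3 : v = d.partner a
    · simp only [if_pos h3]
      have := Trace.up (D := D) (Sum.inr v) ⟨i, Nat.lt_of_succ_lt hi⟩ _ _ (memf _)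
        (by rw [pr, h3, hpp, ha]; rfl) (arriveU _ rfl (d.partner_ne b))
      exact this
    · by_cases h4 : v = d.partner b
      · simp only [if_neg h3, if_pos h4]
        have := Trace.up (D := D) (Sum.inr v) ⟨i + 1, hi⟩ _ _ (memf _)
          (by rw [pr, h4, hpp, hb]; rfl) (arriveU' _ rfl (d.partner_ne a))
        exact this
      · simp only [if_neg h3, if_neg h4]
        exact arrive v _ rfl (fun h => h3 (by rw [← h, hpp])) (fun h => h4 (by rw [← h, hpp]))
  refine ⟨fun v => ?_, fun j => ?_, fun j => ?_⟩
  · by_cases h1 : v = a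
    · have := Trace.last (D := D) (l := List.finRange n) (outer v) b (by rw [h1]; exact oO)
      rw [show D.word (outer v) = [] by rw [h1, ha]; rfl] at this
      simpa [Decorated.join, h1] using this
    · by_cases h2 : v = b
      · have := Trace.last (D := D) (l := List.finRange n) (outer v) a (by rw [h2]; exact oO')
        rw [show D.word (outer v) = [] by rw [h2, hb]; rfl] at this
        simpa [Decorated.join, h2, hab.symm] using this
      · exact start v _ _ h1 h2 (ends v h1 h2)
  · by_cases h1 : j.val = i
    · obtain rfl : j = ⟨i, Nat.lt_of_succ_lt hi⟩ := Fin.ext h1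
      exact ⟨_, _, arriveU _ rfl (d.partner_ne b)⟩
    · by_cases h2 : j.val = i + 1
      · obtain rfl : j = ⟨i + 1, hi⟩ := Fin.ext h2
        exact ⟨_, _, arriveU' _ rfl (d.partner_ne a)⟩
      · exact ⟨_, _, .last _ _ (throughU j h1 h2)⟩
  · change ∃ u w, Trace D _ (Sum.inr (Sum.inl j)) u w
    by_cases h1 : (Sum.inl j : Vertex n) = a
    · rw [h1]
      exact ⟨_, _, arrive a _ rfl (d.partner_ne a) hloop⟩
    · by_cases h2 : (Sum.inl j : Vertex n) = b
      · rw [h2]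
        exact ⟨_, _, arrive b _ rfl hloop' (d.partner_ne b)⟩
      · exact ⟨_, _, ends _ h1 h2⟩

/-- The product of `e` and a diagram: a left blob is inserted at the first vertex on the top. -/
theorem gluesTo_eDiagram (d r : Diagram n) (hp : r.partner = d.partner) (z : Fin n)
    (hz : z.val = 0) (h1 : r.word (Sum.inl z) = Blob.L :: d.word (Sum.inl z))
    (h2 : ∀ v, v ≠ Sum.inl z → v ≠ d.partner (Sum.inl z) → r.word v = d.word v) :
    GluesTo (eDiagram n) d r := by
  set D := (eDiagram n).disjointUnion d with hD
  have memf : ∀ j : Fin n, j ∈ List.finRange n := List.mem_finRange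
  have pr : ∀ v, D.partner (Sum.inr v) = Sum.inr (d.partner v) := fun v => rfl
  have wr : ∀ v, D.word (Sum.inr v) = d.word v := fun v => rfl
  have pU : ∀ j, D.partner (upperMid j) = outer (Sum.inl j) := fun j => rfl
  have pO : ∀ j, D.partner (outer (Sum.inl j)) = upperMid j := fun j => rfl
  -- A uniform formula for all lines: the vertical lines of e contribute their blob both where a
  -- line leaves the top and where it returns to it.
  have wz : ∀ v, r.word v = Sum.elim (fun j : Fin n => if j.val = 0 then [Blob.L] else [])
      (fun _ => []) v ++ d.word v ++
      Sum.elim (fun j : Fin n => if j.val = 0 then [Blob.L] else []) (fun _ => [])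
        (d.partner v) := by
    have hc : ∀ v : Vertex n, v ≠ Sum.inl z →
        Sum.elim (fun j : Fin n => if j.val = 0 then [Blob.L] else []) (fun _ => []) v = [] := by
      rintro (j | j) hj
      · simp only [ne_eq, Sum.inl.injEq, Fin.ext_iff] at hj
        simp only [Sum.elim_inl]
        rw [if_neg (by omega)]
      · rfl
    intro v
    by_cases hv : v = Sum.inl z
    · subst hv
      rw [h1, hc _ (d.partner_ne _)]
      simp [hz]
    · rw [hc v hv]
      by_cases hv' : v = d.partner (Sum.inl z)
      · subst hv'
        rw [← hp, r.word_partner, h1, hp, d.partner_partner, d.word_partner]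
        simp [hz]
      · rw [h2 v hv hv', hc _ (fun h => hv' (by rw [← h, d.partner_partner]))]
        simp
  have ends : ∀ v, Trace D (List.finRange n) (Sum.inr v) (d.partner v) (d.word v ++
      Sum.elim (fun j : Fin n => if j.val = 0 then [Blob.L] else []) (fun _ => [])
        (d.partner v)) := by
    intro v
    rcases hv : d.partner v with j | j
    · exact Trace.up (D := D) (Sum.inr v) j _ _ (memf j) (by rw [pr, hv]; rfl)
        (.last _ _ (pU j))
    · have := Trace.last (D := D) (l := List.finRange n) (Sum.inr v) (Sum.inr j)
        (by rw [pr, hv]; rfl)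
      simpa [wr] using this
  refine ⟨fun v => ?_, fun j => ⟨_, _, .last _ _ (pU j)⟩, fun j => ⟨_, _, ends _⟩⟩
  rw [hp, wz, List.append_assoc]
  rcases v with j | j
  · exact Trace.down (D := D) (outer (Sum.inl j)) j _ _ (memf j) (pO j) (ends (Sum.inl j))
  · exact ends (Sum.inr j)

end Products

end SymplecticBlob

namespace SymplecticBlob

/-! ### Splitting off a left blob at the first top vertex. -/

section Removal

variable {n : ℕ}

/-- The total number of blobs, each counted twice, once from each end of its line. -/
def blobCount (d : Diagram n) : ℕ := ∑ v, (d.word v).length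

theorem blobCount_relabel (σ : Vertex n ≃ Vertex n) (β : Blob → Blob) (d : Diagram n) :
    blobCount (d.relabel σ β) = blobCount d := by
  rw [blobCount, ← Equiv.sum_comp σ]
  simp only [blobCount, Decorated.relabel_word, List.length_map]

/-- Replace the word on the line at `v` by `w`. -/
def Decorated.replaceWord {V : Type} [DecidableEq V] (d : Decorated V) (v : V) (w : List Blob) :
    Decorated V where
  partner := d.partner
  word x := if x = v then w else if x = d.partner v then w.reverse else d.word x
  partner_partner := d.partner_partner
  partner_ne := d.partner_ne
  word_partner := by
    intro x
    have := d.partner_partner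
    have := d.partner_ne
    have := d.word_partner
    grind

theorem head?_eq_some_mem {w : List Blob} {x : Blob} (h : w.head? = some x) : x ∈ w :=
  List.mem_of_mem_head? h

/-- The left blob next to the first vertex on the top can be removed. -/
theorem IsBasisDiagram.replaceWord {d : Diagram n} (hd : IsBasisDiagram d) {z : Fin n}
    (hz : z.val = 0) {w : List Blob} (hw : d.word (Sum.inl z) = Blob.L :: w) :
    IsBasisDiagram (d.replaceWord (Sum.inl z) w) := by
  obtain ⟨⟨h1, h2, h3, h4, h5⟩, h6⟩ := hd
  have hw' : w = [] ∨ w = [Blob.R] := by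
    rcases (h5 (Sum.inl z)).eq with h | h | h | h | h <;> rw [hw] at h <;> simp_all
  have hwp : d.word (d.partner (Sum.inl z)) = w.reverse ++ [Blob.L] := by
    rw [d.word_partner, hw, List.reverse_cons]
  have hword : ∀ v, (d.replaceWord (Sum.inl z) w).word v =
      if v = Sum.inl z then w else if v = d.partner (Sum.inl z) then w.reverse else d.word v :=
    fun v => rfl
  have hmem : ∀ v x, x ∈ (d.replaceWord (Sum.inl z) w).word v → x ∈ d.word v := by
    intro v x hx
    rw [hword] at hx
    split_ifs at hx with c1 c2
    · rw [c1, hw]; simp [hx]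
    · rw [c2, hwp]; simp_all
    · exact hx
  have hheadL : ∀ v, ((d.replaceWord (Sum.inl z) w).word v).head? = some Blob.L →
      (d.word v).head? = some Blob.L ∧ v ≠ Sum.inl z := by
    intro v hv
    rw [hword] at hv
    split_ifs at hv with c1 c2
    · rcases hw' with rfl | rfl <;> simp at hv
    · rcases hw' with rfl | rfl <;> simp at hv
    · exact ⟨hv, c1⟩
  have hheadR : ∀ v, ((d.replaceWord (Sum.inl z) w).word v).head? = some Blob.R →
      (d.word v).head? = some Blob.R ∨ v = Sum.inl z ∧ w = [Blob.R] := by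
    intro v hv
    rw [hword] at hv
    split_ifs at hv with c1 c2
    · rcases hw' with rfl | rfl
      · simp at hv
      · simp [c1]
    · left
      rw [c2, hwp]
      rcases hw' with rfl | rfl <;> simp at hv ⊢
    · exact Or.inl hv
  refine ⟨⟨h1, fun v hv => h2 v (hmem _ _ hv), fun v hv => h3 v (hmem _ _ hv), ⟨?_, ?_⟩, ?_⟩, ?_⟩
  · intro i j hi hj
    obtain ⟨hi, hiz⟩ := hheadL _ hi
    rcases hheadR _ hj with hj | ⟨_, hR⟩
    · exact h4.1 i j hi hj
    -- The right blob has become the first one from `z`, so no other top vertex may start with a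
    -- left blob. Such a vertex `i` would be hidden from the left edge by the line at `z`: this is
    -- clear if the line ends on the bottom, and if it ends at a top vertex `b`, the word there
    -- starts with `R`, which forces `i < b`.
    · exfalso
      have hiz' : i.val ≠ 0 := fun h => hiz (by rw [Sum.inl.injEq, Fin.ext_iff, h, hz])
      refine h2 (Sum.inl i) (head?_eq_some_mem hi) (Sum.inl z) ⟨by simp only [pos]; omega, ?_⟩
      rcases hq : d.partner (Sum.inl z) with b | b
      · rw [hq, hR] at hwp
        exact h4.1 i b hi (by rw [hwp]; rfl)
      · simp only [pos]
        omega
  · intro i j hi hj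
    rcases hheadR _ hj with hj | ⟨hj, _⟩
    · exact h4.2 i j (hheadL _ hi).1 hj
    · simp at hj
  · intro v
    rw [hword]
    split_ifs
    · exact featureFree_of_length_le_one _ (by rcases hw' with rfl | rfl <;> simp)
    · exact featureFree_of_length_le_one _ (by rcases hw' with rfl | rfl <;> simp)
    · exact h5 v
  · have hLR : ∀ v, (d.replaceWord (Sum.inl z) w).word v = [Blob.L, Blob.R] →
        d.word v = [Blob.L, Blob.R] := by
      intro v hv
      rw [hword] at hv
      split_ifs at hv
      · rcases hw' with rfl | rfl <;> simp at hv
      · rcases hw' with rfl | rfl <;> simp at hv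
      · exact hv
    intro i j ⟨a1, a2, a3, a4⟩
    exact h6 i j ⟨hLR _ a1, a2, hLR _ a3, a4⟩

theorem blobCount_replaceWord_lt (d : Diagram n) (v : Vertex n) {x : Blob} {w : List Blob}
    (hw : d.word v = x :: w) : blobCount (d.replaceWord v w) < blobCount d := by
  refine Finset.sum_lt_sum (fun u _ => ?_) ⟨v, Finset.mem_univ v, ?_⟩
  · simp only [Decorated.replaceWord]
    split_ifs with c1 c2
    · rw [c1, hw]; simp
    · rw [c2, d.word_partner, hw]; simp
    · rfl
  · simp [Decorated.replaceWord, hw]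

theorem GeneratorClosed.of_replaceWord {G : Diagram n → Prop} (hG : GeneratorClosed G)
    {d : Diagram n} (hd : IsBasisDiagram d) {z : Fin n} (hz : z.val = 0) {w : List Blob}
    (hw : d.word (Sum.inl z) = Blob.L :: w) (h : G (d.replaceWord (Sum.inl z) w)) : G d := by
  refine hG.mul_left (eDiagram n) _ d (Or.inl rfl) (hd.replaceWord hz hw) hd
    (gluesTo_eDiagram _ _ rfl z hz ?_ ?_) h
  · simp [Decorated.replaceWord, hw]
  · intro v h1 h2
    simp only [Decorated.replaceWord] at h2 ⊢
    rw [if_neg h1, if_neg h2]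

end Removal

/-! ### Sliding an undecorated cup to the right. -/

section CupMove

variable {n : ℕ}

/-- The permutation that moves the top vertices `i` and `i + 1` to the right, past `i + 2`. -/
def shift (i : ℕ) (hi : i + 2 < n) : Equiv.Perm (Vertex n) :=
  Equiv.swap (Sum.inl ⟨i, by omega⟩) (Sum.inl ⟨i + 1, by omega⟩) *
    Equiv.swap (Sum.inl ⟨i + 1, by omega⟩) (Sum.inl ⟨i + 2, hi⟩)

theorem shift_inl (i : ℕ) (hi : i + 2 < n) (j : Fin n) :
    shift i hi (Sum.inl j) = Sum.inl
      (if j.val = i then ⟨i + 1, by omega⟩ else if j.val = i + 1 then ⟨i + 2, hi⟩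
        else if j.val = i + 2 then ⟨i, by omega⟩ else j) := by
  simp only [shift, Equiv.Perm.mul_apply, Equiv.swap_apply_def, Sum.inl.injEq, Fin.ext_iff]
  split_ifs <;> simp_all [Fin.ext_iff]

theorem shift_inr (i : ℕ) (hi : i + 2 < n) (j : Fin n) :
    shift i hi (Sum.inr j) = Sum.inr j := by
  simp [shift, Equiv.swap_apply_def]

theorem isLeft_shift (i : ℕ) (hi : i + 2 < n) (v : Vertex n) :
    (shift i hi v).isLeft = v.isLeft := by
  rcases v with v | v
  · rw [shift_inl]; rfl
  · rw [shift_inr]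

theorem isRight_shift (i : ℕ) (hi : i + 2 < n) (v : Vertex n) :
    (shift i hi v).isRight = v.isRight := by
  rcases v with v | v
  · rw [shift_inl]; rfl
  · rw [shift_inr]

theorem pos_shift (i : ℕ) (hi : i + 2 < n) (v : Vertex n) :
    pos (shift i hi v) = if pos v = i then i + 1 else if pos v = i + 1 then i + 2
      else if pos v = i + 2 then i else pos v := by
  rcases v with v | v
  · rw [shift_inl]
    simp only [pos]
    by_cases h1 : v.val = i
    · simp [h1]
    by_cases h2 : v.val = i + 1
    · simp [h2]
    by_cases h3 : v.val = i + 2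
    · simp [h3]
    simp [h1, h2, h3]
  · rw [shift_inr]
    have hv : n ≤ pos (Sum.inr v : Vertex n) := by simp only [pos]; omega
    rw [if_neg (by omega), if_neg (by omega), if_neg (by omega)]

/-- Move an undecorated line joining the top vertices `i` and `i + 1` to the right. -/
def moveCup (i : ℕ) (hi : i + 2 < n) (d : Diagram n) : Diagram n := d.relabel (shift i hi) id

theorem moveCup_partner (i : ℕ) (hi : i + 2 < n) (d : Diagram n) (v : Vertex n) :
    (moveCup i hi d).partner (shift i hi v) = shift i hi (d.partner v) :=
  d.relabel_partner _ _ v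

theorem moveCup_word (i : ℕ) (hi : i + 2 < n) (d : Diagram n) (v : Vertex n) :
    (moveCup i hi d).word (shift i hi v) = d.word v :=
  (d.relabel_word _ _ v).trans (List.map_id _)

/-- The top vertices `i` and `i + 1` are joined by an undecorated line. -/
def HasCup (d : Diagram n) (i : ℕ) (hi : i + 1 < n) : Prop :=
  d.partner (Sum.inl ⟨i, by omega⟩) = Sum.inl ⟨i + 1, hi⟩ ∧ d.word (Sum.inl ⟨i, by omega⟩) = []

theorem HasCup.moveCup {d : Diagram n} {i : ℕ} {hi : i + 2 < n} (h : HasCup d i (by omega)) :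
    HasCup (moveCup i hi d) (i + 1) hi := by
  have e1 : (Sum.inl ⟨i + 1, by omega⟩ : Vertex n) = shift i hi (Sum.inl ⟨i, by omega⟩) := by
    simp [shift_inl]
  refine ⟨?_, ?_⟩
  · rw [e1, moveCup_partner, h.1, shift_inl]
    simp
  · rw [e1, moveCup_word, h.2]

theorem HasCup.pos_partner {d : Diagram n} {i : ℕ} {hi : i + 1 < n} (h : HasCup d i hi)
    (v : Vertex n) : (pos v = i ∧ pos (d.partner v) = i + 1 ∧ d.word v = []) ∨
      (pos v = i + 1 ∧ pos (d.partner v) = i ∧ d.word v = []) ∨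
      (pos v ≠ i ∧ pos v ≠ i + 1 ∧ pos (d.partner v) ≠ i ∧ pos (d.partner v) ≠ i + 1) := by
  set a : Vertex n := Sum.inl ⟨i, by omega⟩ with ha
  set b : Vertex n := Sum.inl ⟨i + 1, hi⟩ with hb
  have pa : pos a = i := rfl
  have pb : pos b = i + 1 := rfl
  have hab : d.partner a = b := h.1
  have hba : d.partner b = a := by rw [← hab, d.partner_partner]
  have ea : ∀ v, pos v = i → v = a := fun v hv => pos_injective (by rw [hv, pa])
  have eb : ∀ v, pos v = i + 1 → v = b := fun v hv => pos_injective (by rw [hv, pb])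
  have wa : d.word a = [] := h.2
  have wb : d.word b = [] := by rw [← hab, d.word_partner, wa]; rfl
  by_cases h1 : pos v = i
  · left
    obtain rfl := ea v h1
    exact ⟨pa, by rw [hab, pb], wa⟩
  by_cases h2 : pos v = i + 1
  · right; left
    obtain rfl := eb v h2
    exact ⟨pb, by rw [hba, pa], wb⟩
  right; right
  refine ⟨h1, h2, fun h3 => h2 ?_, fun h3 => h1 ?_⟩
  · rw [← d.partner_partner v, ea _ h3, hab, pb]
  · rw [← d.partner_partner v, eb _ h3, hba, pa]

/-- The remaining vertices keep their order and their edges. The cup joins neighbours, so it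
encloses nothing and cannot be separated by another line, and it carries no blob, so no condition on
blobs concerns it. -/
theorem IsBasisDiagram.moveCup {d : Diagram n} (hd : IsBasisDiagram d) {i : ℕ} {hi : i + 2 < n}
    (h : HasCup d i (by omega)) : IsBasisDiagram (moveCup i hi d) := by
  obtain ⟨⟨h1, h2, h3, h4, h5⟩, h6⟩ := hd
  have ex : ∀ v, ∃ u, shift i hi u = v := (shift i hi).surjective
  have cup := h.pos_partner
  have lt_iff : ∀ u v : Vertex n, pos u ≠ i → pos u ≠ i + 1 → pos v ≠ i → pos v ≠ i + 1 →
      (pos (shift i hi u) < pos (shift i hi v) ↔ pos u < pos v) := by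
    intro u v c1 c2 c3 c4
    rw [pos_shift, pos_shift, if_neg c1, if_neg c2, if_neg c3, if_neg c4]
    split_ifs <;> omega
  have ge_iff : ∀ v : Vertex n, (n ≤ pos (shift i hi v) ↔ n ≤ pos v) := by
    intro v
    rw [pos_shift]
    split_ifs <;> omega
  have notcup : ∀ v : Vertex n, pos v ≠ i → pos v ≠ i + 1 →
      pos (shift i hi v) ≠ i + 1 ∧ pos (shift i hi v) ≠ i + 2 := by
    intro v c1 c2
    rw [pos_shift]
    split_ifs <;> omega
  have inside_cup : ∀ u v, pos u = i ∨ pos u = i + 1 →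
      ¬ (SymplecticBlob.moveCup i hi d).Inside (shift i hi u) (shift i hi v) := by
    intro u v hu
    rw [Diagram.Inside, moveCup_partner, pos_shift, pos_shift, pos_shift]
    rcases cup u with c | c | c
    · simp only [c.1, c.2.1]
      split_ifs <;> omega
    · simp only [c.1, c.2.1]
      split_ifs <;> omega
    · omega
  have inside_iff : ∀ u v, pos u ≠ i → pos u ≠ i + 1 → pos v ≠ i → pos v ≠ i + 1 →
      ((SymplecticBlob.moveCup i hi d).Inside (shift i hi u) (shift i hi v) ↔ d.Inside u v) := by
    intro u v c1 c2 c3 c4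
    rcases cup u with c | c | c
    · omega
    · omega
    · rw [Diagram.Inside, Diagram.Inside, moveCup_partner, lt_iff u v c1 c2 c3 c4,
        lt_iff v _ c3 c4 c.2.2.1 c.2.2.2]
  have dec : ∀ v x, x ∈ d.word v → pos v ≠ i ∧ pos v ≠ i + 1 := by
    intro v x hx
    rcases cup v with c | c | c
    · rw [c.2.2] at hx; simp at hx
    · rw [c.2.2] at hx; simp at hx
    · exact ⟨c.1, c.2.1⟩
  refine ⟨⟨?_, ?_, ?_, ?_, ?_⟩, ?_⟩
  · intro u v
    obtain ⟨u, rfl⟩ := ex u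
    obtain ⟨v, rfl⟩ := ex v
    intro huv
    by_cases hu : pos u = i ∨ pos u = i + 1
    · exact absurd huv (inside_cup u v hu)
    push Not at hu
    rcases cup v with c | c | c
    · rw [Diagram.Inside, moveCup_partner] at huv
      rw [Diagram.Inside, moveCup_partner, moveCup_partner]
      have hu' : pos (d.partner u) ≠ i ∧ pos (d.partner u) ≠ i + 1 := by
        rcases cup u with c' | c' | c' <;> omega
      have n1 := notcup u hu.1 hu.2
      have n2 := notcup _ hu'.1 hu'.2
      rw [pos_shift i hi v, if_pos c.1] at huv
      rw [pos_shift i hi (d.partner v), if_neg (by omega), if_pos c.2.1]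
      omega
    · rw [Diagram.Inside, moveCup_partner] at huv
      rw [Diagram.Inside, moveCup_partner, moveCup_partner]
      have hu' : pos (d.partner u) ≠ i ∧ pos (d.partner u) ≠ i + 1 := by
        rcases cup u with c' | c' | c' <;> omega
      have n1 := notcup u hu.1 hu.2
      have n2 := notcup _ hu'.1 hu'.2
      rw [pos_shift i hi v, if_neg (by omega), if_pos c.1] at huv
      rw [pos_shift i hi (d.partner v), if_pos c.2.1]
      omega
    · rw [inside_iff u v hu.1 hu.2 c.1 c.2.1] at huv
      rw [moveCup_partner, inside_iff _ _ hu.1 hu.2 c.2.2.1 c.2.2.2]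
      exact h1 u v huv
  · intro v hv u
    obtain ⟨u, rfl⟩ := ex u
    obtain ⟨v, rfl⟩ := ex v
    rw [moveCup_word] at hv
    by_cases hu : pos u = i ∨ pos u = i + 1
    · exact inside_cup u v hu
    push Not at hu
    rw [inside_iff u v hu.1 hu.2 (dec v _ hv).1 (dec v _ hv).2]
    exact h2 v hv u
  · intro v hv u
    obtain ⟨u, rfl⟩ := ex u
    obtain ⟨v, rfl⟩ := ex v
    rw [moveCup_word] at hv
    intro b1 b2 b3
    rw [moveCup_partner] at b1 b3 ⊢
    by_cases hu : pos u = i ∨ pos u = i + 1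
    · have := inside_cup u v hu
      have b4 : ¬ n ≤ pos (d.partner u) := by rcases cup u with c | c | c <;> omega
      rw [ge_iff]
      tauto
    push Not at hu
    have hu' : pos (d.partner u) ≠ i ∧ pos (d.partner u) ≠ i + 1 := by
      rcases cup u with c' | c' | c' <;> omega
    rw [lt_iff _ _ hu.1 hu.2 hu'.1 hu'.2] at b1
    rw [inside_iff u v hu.1 hu.2 (dec v _ hv).1 (dec v _ hv).2, ge_iff,
      h3 v hv u b1 (fun h => b2 (by rw [h])) (fun h => b3 (by rw [h]))]
    have := ge_iff u
    omega
  · refine ⟨fun p q hp hq => ?_, fun p q hp hq => ?_⟩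
    · obtain ⟨u, hu⟩ := ex (Sum.inl p)
      obtain ⟨v, hv⟩ := ex (Sum.inl q)
      rw [← hu, moveCup_word] at hp
      rw [← hv, moveCup_word] at hq
      have du := dec u _ (head?_eq_some_mem hp)
      have dv := dec v _ (head?_eq_some_mem hq)
      have hlt := lt_iff u v du.1 du.2 dv.1 dv.2
      rw [hu, hv] at hlt
      rcases u with u | u
      · rcases v with v | v
        · exact hlt.2 (h4.1 u v hp hq)
        · rw [shift_inr] at hv; simp at hv
      · rw [shift_inr] at hu; simp at hu
    · rw [← shift_inr i hi, moveCup_word] at hp hq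
      exact h4.2 p q hp hq
  · intro v
    obtain ⟨v, rfl⟩ := ex v
    rw [moveCup_word]
    exact h5 v
  · intro p q ⟨a1, a2, a3, a4⟩
    obtain ⟨u, hu⟩ := ex (Sum.inl p)
    rw [← hu, moveCup_word] at a1
    rw [← hu, moveCup_partner, isLeft_shift] at a2
    rw [← shift_inr i hi, moveCup_word] at a3
    rw [← shift_inr i hi, moveCup_partner, isRight_shift] at a4
    rcases u with u | u
    · exact h6 u q ⟨a1, a2, a3, a4⟩
    · rw [shift_inr] at hu; simp at hu

/-- Zigzag: from the top vertex `i + 2` one goes down to the moved cup, along it to `i + 1`, back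
along the bottom line of e_{i+1} to `i`, and there meets the line that `d` has at `i + 2`. -/
theorem gluesTo_moveCup {d : Diagram n} {i : ℕ} {hi : i + 2 < n} (h : HasCup d i (by omega)) :
    GluesTo (cupCapDiagram n i (by omega)) (moveCup i hi d) d := by
  set a : Vertex n := Sum.inl ⟨i, by omega⟩ with ha
  set b : Vertex n := Sum.inl ⟨i + 1, by omega⟩ with hb
  set c : Vertex n := Sum.inl ⟨i + 2, hi⟩ with hc
  have hab : a ≠ b := by simp [ha, hb]
  have hac : a ≠ c := by simp [ha, hc]
  have hbc : b ≠ c := by simp [hb, hc]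
  have dab : d.partner a = b := h.1
  have dba : d.partner b = a := by rw [← dab, d.partner_partner]
  have wa : d.word a = [] := h.2
  have wb : d.word b = [] := by rw [← dab, d.word_partner, wa]; rfl
  have sa : shift i hi a = b := by simp [ha, hb, shift_inl]
  have sb : shift i hi b = c := by simp [hc, hb, shift_inl]
  have sc : shift i hi c = a := by simp [hc, ha, shift_inl]
  have sx : ∀ x, x ≠ a → x ≠ b → x ≠ c → shift i hi x = x := by
    intro x h1 h2 h3
    have : shift i hi = Equiv.swap a b * Equiv.swap b c := rfl
    rw [this, Equiv.Perm.mul_apply, Equiv.swap_apply_of_ne_of_ne h2 h3,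
      Equiv.swap_apply_of_ne_of_ne h1 h2]
  have pa : (moveCup i hi d).partner a = shift i hi (d.partner c) := by rw [← sc, moveCup_partner]
  have pb : (moveCup i hi d).partner b = c := by
    have := moveCup_partner i hi d a
    rwa [sa, dab, sb] at this
  have pc : (moveCup i hi d).partner c = b := by rw [← pb, Decorated.partner_partner]
  have wa' : (moveCup i hi d).word a = d.word c := by rw [← sc, moveCup_word]
  have wb' : (moveCup i hi d).word b = [] := by
    have := moveCup_word i hi d a
    rwa [sa, wa] at this
  have wc' : (moveCup i hi d).word c = [] := by
    have := moveCup_word i hi d b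
    rwa [sb, wb] at this
  have hpp := d.partner_partner
  have hne := d.partner_ne
  have py : shift i hi (d.partner c) = d.partner c := by
    apply sx
    · intro h; rw [← h, hpp] at dab; exact hbc dab.symm
    · intro h; rw [← h, hpp] at dba; exact hac dba.symm
    · exact hne c
  have px : ∀ x, x ≠ a → x ≠ b → x ≠ c → x ≠ d.partner c →
      (moveCup i hi d).partner x = d.partner x := by
    intro x h1 h2 h3 h4
    have := moveCup_partner i hi d x
    rw [sx x h1 h2 h3] at this
    rw [this]
    apply sx
    · intro h; rw [← h, hpp] at dab; exact h2 dab
    · intro h; rw [← h, hpp] at dba; exact h1 dba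
    · intro h; exact h4 (by rw [← h, hpp])
  have wx : ∀ x, x ≠ a → x ≠ b → x ≠ c → (moveCup i hi d).word x = d.word x := by
    intro x h1 h2 h3
    have := moveCup_word i hi d x
    rwa [sx x h1 h2 h3] at this
  rw [py] at pa
  have hloop : (moveCup i hi d).partner a ≠ b := by
    rw [pa]
    intro h; rw [← h, hpp] at dba; exact hac dba.symm
  have key : (moveCup i hi d).join a b hab = d := by
    ext1
    · funext x
      simp only [Decorated.join, pa, pb]
      grind
    · funext x
      simp only [Decorated.join, pa, pb, wa', wb']
      split_ifs with c1 c2 c3 c4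
      · rw [c1, wa]
      · rw [c2, wb]
      · rw [List.append_nil]
        exact wx x c1 c2 (c3 ▸ hne c)
      · rw [c4, wc', List.nil_append]
      · exact wx x c1 c2 c4
  have := gluesTo_cupCapDiagram (moveCup i hi d) i (by omega) a b rfl rfl hab hloop
  rwa [key] at this

theorem GeneratorClosed.of_moveCup {G : Diagram n → Prop} (hG : GeneratorClosed G)
    {d : Diagram n} (hd : IsBasisDiagram d) {i : ℕ} {hi : i + 2 < n} (h : HasCup d i (by omega))
    (hm : G (moveCup i hi d)) : G d :=
  hG.mul_left _ _ d (Or.inr (Or.inr ⟨i, by omega, rfl⟩)) (hd.moveCup h) hd (gluesTo_moveCup h) hm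

end CupMove

end SymplecticBlob

namespace SymplecticBlob

/-! ### Cups joining neighbours. -/

section InnermostCup

variable {n : ℕ}

/-- Below an undecorated line with both ends on the top there is an undecorated line that joins two
neighbours. -/
theorem IsBasisDiagram.exists_hasCup {d : Diagram n} (hd : IsBasisDiagram d) (a b : Fin n)
    (hlt : a < b) (hab : d.partner (Sum.inl a) = Sum.inl b) (hw : d.word (Sum.inl a) = []) :
    ∃ (i : ℕ) (hi : i + 1 < n), i + 1 ≤ b.val ∧ HasCup d i hi := by
  induction hm : b.val - a.val using Nat.strong_induction_on generalizing a b with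
  | _ m ih =>
    subst hm
    have hlt' : a.val < b.val := hlt
    by_cases hb : b.val = a.val + 1
    · have hab' : b = ⟨a.val + 1, by omega⟩ := Fin.ext hb
      exact ⟨a.val, by omega, by omega, by rw [← hab']; exact hab, hw⟩
    set c : Fin n := ⟨a.val + 1, by omega⟩ with hc
    have hin : d.Inside (Sum.inl a) (Sum.inl c) := by
      refine ⟨?_, ?_⟩
      · simp only [pos, hc]; omega
      · rw [hab]; simp only [pos, hc]; omega
    have hin' := hd.1.noncrossing _ _ hin
    rw [Diagram.Inside, hab] at hin'
    rcases hq : d.partner (Sum.inl c) with q | q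
    · rw [hq] at hin'
      simp only [pos] at hin'
      have hqc : q ≠ c := by
        intro h
        rw [h] at hq
        exact d.partner_ne _ hq
      have hqc' : q.val ≠ a.val + 1 := fun h => hqc (Fin.ext h)
      -- The line from `a` to `b` has both ends on the top, so it separates `c` from the left edge
      -- and from the right edge.
      have hwc : d.word (Sum.inl c) = [] := by
        rw [List.eq_nil_iff_forall_not_mem]
        rintro (_ | _) hx
        · exact hd.1.left_exposed _ hx _ hin
        · have := (hd.1.right_exposed _ hx (Sum.inl a) (by rw [hab]; exact hlt') (by
            simp only [ne_eq, Sum.inl.injEq, Fin.ext_iff, hc]; omega) (by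
            rw [hab]
            simp only [ne_eq, Sum.inl.injEq, Fin.ext_iff, hc]; omega)).1 hin
          rw [hab] at this
          simp only [pos] at this
          omega
      obtain ⟨i, hi, h1, h2⟩ := ih (q.val - c.val) (by simp only [hc]; omega) c q
        (Fin.lt_def.2 (by simp only [hc]; omega)) hq hwc rfl
      exact ⟨i, hi, by omega, h2⟩
    · rw [hq] at hin'
      simp only [pos] at hin'
      omega

end InnermostCup

/-! ### Induction on the number of blobs. -/

section RemoveBlobs

variable {n : ℕ}

/-- `m` counts the vertices between the cup and `p`. The cup slides right until it is next to `p`;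
the last move carries `p` to `p - 2`, where `IH` applies. Moves do not change the number of blobs.
-/
theorem GeneratorClosed.of_cup_of_head {G : Diagram n → Prop} (hG : GeneratorClosed G) (p : ℕ)
    (B : ℕ) (IH : ∀ q, q < p → ∀ hq : q < n, ∀ d, IsBasisDiagram d → blobCount d = B →
      (d.word (Sum.inl ⟨q, hq⟩)).head? = some Blob.L → G d) (m : ℕ) :
    ∀ (i : ℕ) (hp : p < n) (hi : i + 1 < p), p = i + 2 + m → ∀ d, IsBasisDiagram d →
      blobCount d = B → (d.word (Sum.inl ⟨p, hp⟩)).head? = some Blob.L →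
      HasCup d i (by omega) → G d := by
  induction m with
  | zero =>
    intro i hp hi hm d hd hB hL hcup
    subst hm
    refine hG.of_moveCup (hi := hp) hd hcup (IH i (by omega) (by omega) _ (hd.moveCup hcup) ?_ ?_)
    · rw [moveCup, blobCount_relabel, hB]
    · rw [← hL, ← moveCup_word i hp d, shift_inl]
      simp
  | succ m ih =>
    intro i hp hi hm d hd hB hL hcup
    refine hG.of_moveCup (hi := by omega) hd hcup (ih (i + 1) hp (by omega) (by omega) _
      (hd.moveCup hcup) ?_ ?_ hcup.moveCup)
    · rw [moveCup, blobCount_relabel, hB]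
    · rw [← hL, ← moveCup_word i (by omega) d (Sum.inl ⟨p, hp⟩), shift_inl]
      rw [if_neg (by simp; omega), if_neg (by simp; omega), if_neg (by simp; omega)]

/-- A left blob that is the first one from a vertex on the top can be removed. -/
theorem GeneratorClosed.of_head_left {G : Diagram n → Prop} (hG : GeneratorClosed G) (B : ℕ)
    (hB : ∀ d, IsBasisDiagram d → blobCount d < B → G d) (p : ℕ) :
    ∀ (hp : p < n) (d : Diagram n), IsBasisDiagram d → blobCount d = B →
      (d.word (Sum.inl ⟨p, hp⟩)).head? = some Blob.L → G d := by
  induction p using Nat.strong_induction_on with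
  | _ p ih =>
    intro hp d hd hdB hL
    obtain ⟨w, hw⟩ : ∃ w, d.word (Sum.inl ⟨p, hp⟩) = Blob.L :: w := by
      rcases h : d.word (Sum.inl ⟨p, hp⟩) with _ | ⟨x, w⟩
      · simp [h] at hL
      · rw [h] at hL
        simp only [List.head?_cons, Option.some.injEq] at hL
        exact ⟨w, by rw [hL]⟩
    rcases Nat.eq_zero_or_pos p with rfl | hpos
    · refine hG.of_replaceWord hd rfl hw (hB _ (hd.replaceWord rfl hw) ?_)
      rw [← hdB]
      exact blobCount_replaceWord_lt d _ hw
    by_cases hmin : ∃ q, ∃ h : q < p,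
        (d.word (Sum.inl ⟨q, h.trans hp⟩)).head? = some Blob.L
    · obtain ⟨q, h, hq⟩ := hmin
      exact ih q h (h.trans hp) d hd hdB hq
    push Not at hmin
    set v : Vertex n := Sum.inl ⟨p - 1, by omega⟩ with hv
    -- A left blob first is excluded by the minimality of `p`, and a right blob first would be to
    -- the left of the left blob at `p`, against simultaneity.
    have hwv : d.word v = [] := by
      rcases h : d.word v with _ | ⟨_ | _, w'⟩
      · rfl
      · exact absurd (by rw [← hv, h]; rfl) (hmin (p - 1) (by omega))
      · have := hd.1.simultaneous.1 ⟨p, hp⟩ ⟨p - 1, by omega⟩ hL (by rw [← hv, h]; rfl)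
        rw [Fin.lt_def] at this
        simp only at this
        omega
    -- The line at `p - 1` may not enclose the exposed vertex `p`, and it does not end at `p`
    -- because the line there is decorated.
    have hle : pos (d.partner v) < p - 1 := by
      have h1 := hd.1.left_exposed _ (head?_eq_some_mem hL) v
      have h2 : pos (d.partner v) ≠ pos v := fun h => d.partner_ne v (pos_injective h)
      have h3 : pos (d.partner v) ≠ p := by
        intro h
        have h4 : d.partner v = Sum.inl ⟨p, hp⟩ := pos_injective h
        have := d.word_partner v
        rw [h4, hw, hwv] at this
        simp at this
      have h4 : pos v = p - 1 := rfl
      have h5 : pos (Sum.inl ⟨p, hp⟩ : Vertex n) = p := rfl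
      rw [Diagram.Inside, h4, h5] at h1
      omega
    rcases hq : d.partner v with q | q
    · rw [hq] at hle
      have hle' : q.val < p - 1 := hle
      have hwq : d.word (Sum.inl q) = [] := by rw [← hq, d.word_partner, hwv]; rfl
      obtain ⟨i, hi, h1, h2⟩ := hd.exists_hasCup q ⟨p - 1, by omega⟩ (Fin.lt_def.2 hle')
        (by rw [← hq, d.partner_partner]) hwq
      simp only at h1
      exact hG.of_cup_of_head p B (fun q hqp hqn => ih q hqp hqn) (p - i - 2) i hp (by omega)
        (by omega) d hd hdB hL h2
    · rw [hq] at hle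
      simp only [pos] at hle
      omega

theorem blobCount_flip (d : Diagram n) : blobCount (flip d) = blobCount d :=
  blobCount_relabel _ _ _

theorem blobCount_mirror (d : Diagram n) : blobCount (mirror d) = blobCount d :=
  blobCount_relabel _ _ _

/-- If a right blob comes first, the mirrored diagram has a left blob first. The induction
hypothesis carries over since reflection preserves the number of blobs. -/
theorem GeneratorClosed.of_top_blob {G : Diagram n → Prop} (hG : GeneratorClosed G) (B : ℕ)
    (hB : ∀ d, IsBasisDiagram d → blobCount d < B → G d) {d : Diagram n}
    (hd : IsBasisDiagram d) (hdB : blobCount d = B) (i : Fin n)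
    (hi : d.word (Sum.inl i) ≠ []) : G d := by
  rcases h : d.word (Sum.inl i) with _ | ⟨_ | _, w⟩
  · exact absurd h hi
  · exact hG.of_head_left B hB i.val i.isLt d hd hdB (by rw [Fin.eta, h]; rfl)
  · have := hG.comp_mirror.of_head_left B
      (fun d' hd' hlt => hB _ hd'.mirror (by rwa [blobCount_mirror]))
      i.rev.val i.rev.isLt (mirror d) hd.mirror (by rw [blobCount_mirror, hdB]) (by
        have := mirror_word d (Sum.inl i)
        rw [h, show mirrorVertex (Sum.inl i) = Sum.inl i.rev from rfl] at this
        rw [Fin.eta, this]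
        rfl)
    rwa [mirror_mirror] at this

theorem GeneratorClosed.of_blob {G : Diagram n → Prop} (hG : GeneratorClosed G) (B : ℕ)
    (hB : ∀ d, IsBasisDiagram d → blobCount d < B → G d) {d : Diagram n}
    (hd : IsBasisDiagram d) (hdB : blobCount d = B) (v : Vertex n) (hv : d.word v ≠ []) : G d := by
  rcases v with i | i
  · exact hG.of_top_blob B hB hd hdB i hv
  · have := hG.comp_flip.of_top_blob B (fun d' hd' hlt => hB _ hd'.flip (by rwa [blobCount_flip]))
      hd.flip (by rw [blobCount_flip, hdB]) i (by
        have := flip_word d (Sum.inr i)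
        rw [Sum.swap_inr] at this
        rwa [this])
    rwa [flip_flip] at this

end RemoveBlobs

/-! ### Undecorated diagrams, by induction on the non-propagating lines. -/

section Undecorated

variable {n : ℕ}

/-- The number of vertices on lines with both ends on the same edge. -/
def cupCount (d : Diagram n) : ℕ :=
  (Finset.univ.filter fun v => (d.partner v).isLeft = v.isLeft).card

theorem cupCount_relabel (σ : Vertex n ≃ Vertex n)
    (hσ : ∀ u v, (σ u).isLeft = (σ v).isLeft ↔ u.isLeft = v.isLeft) (d : Diagram n) :
    cupCount (d.relabel σ id) = cupCount d := by
  symm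
  refine Finset.card_equiv σ fun v => ?_
  simp [hσ]

theorem cupCount_flip (d : Diagram n) : cupCount (flip d) = cupCount d := by
  refine cupCount_relabel _ ?_ d
  rintro (u | u) (v | v) <;> simp

theorem cupCount_moveCup (i : ℕ) (hi : i + 2 < n) (d : Diagram n) :
    cupCount (moveCup i hi d) = cupCount d :=
  cupCount_relabel _ (fun u v => by rw [isLeft_shift, isLeft_shift]) d

/-- An undecorated line joining neighbours on the top can be moved to the right end. -/
theorem GeneratorClosed.of_cup_last {G : Diagram n → Prop} (hG : GeneratorClosed G) (m : ℕ)
    (hm : m + 2 = n) (K : Diagram n → Prop) (hK : ∀ i hi d, K d → K (moveCup i hi d))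
    (hlast : ∀ d, IsBasisDiagram d → K d → HasCup d m (by omega) → G d) (j : ℕ) :
    ∀ i hi d, i + j = m → IsBasisDiagram d → K d → HasCup d i hi → G d := by
  -- `K` carries whatever must survive the moves; `j` is the distance still to go.
  induction j with
  | zero =>
    intro i hi d him hd hKd hcup
    obtain rfl : i = m := him
    exact hlast d hd hKd hcup
  | succ j ih =>
    intro i hi d him hd hKd hcup
    exact hG.of_moveCup (hi := by omega) hd hcup
      (ih (i + 1) (by omega) _ (by omega) (hd.moveCup hcup) (hK i _ d hKd) hcup.moveCup)

/-- Replace the lines at the last two vertices by two vertical undecorated lines, if these four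
vertices are joined to each other. -/
def straightenLast (d : Diagram n) (a b a' b' : Vertex n) (hnd : [a, b, a', b'].Nodup)
    (hab : d.partner a = b) (hab' : d.partner a' = b') : Diagram n where
  partner x := if x = a then a' else if x = b then b' else if x = a' then a
    else if x = b' then b else d.partner x
  word x := if x = a ∨ x = b ∨ x = a' ∨ x = b' then [] else d.word x
  partner_partner := by
    intro x
    have := d.partner_partner
    have := d.partner_ne
    simp at hnd
    grind
  partner_ne := by
    intro x
    have := d.partner_partner
    have := d.partner_ne
    simp at hnd
    grind
  word_partner := by
    intro x
    have := d.partner_partner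
    have := d.partner_ne
    have := d.word_partner
    simp at hnd
    grind

theorem isBasisDiagram_of_undecorated {d : Diagram n} (hd : d.Noncrossing)
    (hw : ∀ v, d.word v = []) : IsBasisDiagram d := by
  refine ⟨⟨hd, ?_, ?_, ⟨?_, ?_⟩, ?_⟩, ?_⟩
  · intro v hv; simp [hw] at hv
  · intro v hv; simp [hw] at hv
  · intro i j hi; simp [hw] at hi
  · intro i j hi; simp [hw] at hi
  · intro v
    exact featureFree_of_length_le_one _ (by simp [hw])
  · intro i j h
    simpa [hw] using h.1

/-- Multiplying two vertical lines at the last two places by e_{n-1} recreates the cups on the top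
and on the bottom. Thus `d` is e_{n-1} times a diagram with these cups replaced by vertical lines,
whose `cupCount` is smaller. -/
theorem GeneratorClosed.of_two_cups_last {G : Diagram n → Prop} (hG : GeneratorClosed G) (m : ℕ)
    (hm : m + 2 = n) (C : ℕ)
    (IH : ∀ d, IsBasisDiagram d → (∀ v, d.word v = []) → cupCount d < C → G d) {d : Diagram n}
    (hd : IsBasisDiagram d) (hw : ∀ v, d.word v = []) (hC : cupCount d = C)
    (htop : HasCup d m (by omega)) (hbot : HasCup (flip d) m (by omega)) : G d := by
  set a : Vertex n := Sum.inl ⟨m, by omega⟩ with ha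
  set b : Vertex n := Sum.inl ⟨m + 1, by omega⟩ with hb
  set a' : Vertex n := Sum.inr ⟨m, by omega⟩ with ha'
  set b' : Vertex n := Sum.inr ⟨m + 1, by omega⟩ with hb'
  have hnd : [a, b, a', b'].Nodup := by simp [ha, hb, ha', hb']
  have hab : d.partner a = b := htop.1
  have hab' : d.partner a' = b' := by
    have := flip_partner (flip d) (Sum.inl ⟨m, by omega⟩)
    rw [hbot.1, flip_flip] at this
    exact this
  set r := straightenLast d a b a' b' hnd hab hab' with hr
  have rp : ∀ x, r.partner x = if x = a then a' else if x = b then b' else if x = a' then a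
    else if x = b' then b else d.partner x := fun x => rfl
  have rw' : ∀ v, r.word v = [] := by
    intro v
    simp only [hr, straightenLast, hw, ite_self]
  have hpp := d.partner_partner
  -- Clockwise, around the right edge, the order is `a`, `b`, `b'`, `a'`. These are consecutive
  -- positions, so reconnecting them creates no crossing with other lines.
  have pa : pos a = m := rfl
  have pb : pos b = m + 1 := rfl
  have pa' : pos a' = m + 3 := by simp only [ha', pos]; omega
  have pb' : pos b' = m + 2 := by simp only [hb', pos]; omega
  have other : ∀ x, x ≠ a → x ≠ b → x ≠ a' → x ≠ b' →
      (pos x < m ∨ m + 3 < pos x) ∧ (pos (d.partner x) < m ∨ m + 3 < pos (d.partner x)) := by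
    have hpos : ∀ x, x ≠ a → x ≠ b → x ≠ a' → x ≠ b' → pos x < m ∨ m + 3 < pos x := by
      intro x h1 h2 h3 h4
      have i1 : pos x ≠ pos a := fun h => h1 (pos_injective h)
      have i2 : pos x ≠ pos b := fun h => h2 (pos_injective h)
      have i3 : pos x ≠ pos a' := fun h => h3 (pos_injective h)
      have i4 : pos x ≠ pos b' := fun h => h4 (pos_injective h)
      omega
    intro x h1 h2 h3 h4
    refine ⟨hpos x h1 h2 h3 h4, hpos _ ?_ ?_ ?_ ?_⟩
    · grind
    · grind
    · grind
    · grind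
  have hrp : ∀ x, (pos x = m ∧ pos (r.partner x) = m + 3) ∨
      (pos x = m + 1 ∧ pos (r.partner x) = m + 2) ∨ (pos x = m + 2 ∧ pos (r.partner x) = m + 1) ∨
      (pos x = m + 3 ∧ pos (r.partner x) = m) ∨ ((pos x < m ∨ m + 3 < pos x) ∧
        (pos (d.partner x) < m ∨ m + 3 < pos (d.partner x)) ∧ r.partner x = d.partner x) := by
    intro x
    rw [rp]
    split_ifs with h1 h2 h3 h4
    · exact Or.inl ⟨by rw [h1, pa], pa'⟩
    · exact Or.inr (Or.inl ⟨by rw [h2, pb], pb'⟩)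
    · exact Or.inr (Or.inr (Or.inr (Or.inl ⟨by rw [h3, pa'], pa⟩)))
    · exact Or.inr (Or.inr (Or.inl ⟨by rw [h4, pb'], pb⟩))
    · have := other x h1 h2 h3 h4
      exact Or.inr (Or.inr (Or.inr (Or.inr ⟨this.1, this.2, rfl⟩)))
  have hrb : IsBasisDiagram r := by
    refine isBasisDiagram_of_undecorated ?_ rw'
    intro u v
    have h := hd.1.noncrossing u v
    simp only [Diagram.Inside] at *
    rcases hrp u with c | c | c | c | c <;> rcases hrp v with c' | c' | c' | c' | c' <;>
      (try rw [c.2.2]) <;> (try rw [c'.2.2]) <;> omega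
  have hlt : cupCount r < C := by
    rw [← hC]
    refine Finset.card_lt_card ?_
    rw [Finset.ssubset_iff_of_subset]
    · refine ⟨a, ?_, ?_⟩
      · rw [Finset.mem_filter, hab]
        exact ⟨Finset.mem_univ a, rfl⟩
      · simp [rp, ha, ha']
    · intro x
      simp only [Finset.mem_filter, Finset.mem_univ, true_and, rp]
      split_ifs with h1 h2 h3 h4
      · simp [h1, ha, ha']
      · simp [h2, hb, hb']
      · simp [h3, ha, ha']
      · simp [h4, hb, hb']
      · exact id
  have hab_ne : a ≠ b := by simp [ha, hb]
  have hloop : r.partner a ≠ b := by simp [rp, ha', hb]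
  have key : r.join a b hab_ne = d := by
    ext1
    · funext x
      simp only [Decorated.join, rp]
      simp at hnd
      grind
    · funext x
      simp only [Decorated.join, rw', hw, List.append_nil, ite_self]
  have hglue := gluesTo_cupCapDiagram r m (by omega) a b rfl rfl hab_ne hloop
  rw [key] at hglue
  exact hG.mul_left _ r d (Or.inr (Or.inr ⟨m, by omega, rfl⟩)) hrb hd hglue (IH r hrb rw' hlt)

/-- A noncrossing diagram all of whose lines are propagating is vertical. -/
theorem eq_identityDiagram {d : Diagram n} (hd : d.Noncrossing) (hw : ∀ v, d.word v = [])
    (hp : ∀ i, (d.partner (Sum.inl i)).isRight = true) : d = identityDiagram n := by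
  have hp' : ∀ i, ∃ j, d.partner (Sum.inl i) = Sum.inr j := fun i => Sum.isRight_iff.1 (hp i)
  choose g hg using hp'
  have hmono : StrictMono g := by
    intro i j hij
    have h := hd (Sum.inl i) (Sum.inl j) ⟨hij, by rw [hg]; simp only [pos]; omega⟩
    rw [Diagram.Inside, hg, hg] at h
    simp only [pos] at h
    rw [Fin.lt_def]
    omega
  -- A strictly increasing map from `Fin n` to itself is surjective, and it is determined by its
  -- range.
  have hid : ∀ i, g i = i := by
    have hsurj := Finite.surjective_of_injective hmono.injective
    intro i
    have := (hmono.range_inj strictMono_id).1 (by rw [hsurj.range_eq, Set.range_id])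
    rw [this]; rfl
  ext1
  · funext v
    rcases v with v | v
    · rw [hg, hid]; rfl
    · have := hg v
      rw [hid] at this
      have h := congrArg d.partner this
      rw [d.partner_partner] at h
      exact h.symm
  · funext v
    rw [hw]
    rcases v with v | v <;> simp [identityDiagram, verticalDiagram]

/-- An undecorated line that joins two neighbours on the top. -/
theorem IsBasisDiagram.exists_hasCup_of_isLeft {d : Diagram n} (hd : IsBasisDiagram d)
    (hw : ∀ v, d.word v = []) (i : Fin n) (hi : (d.partner (Sum.inl i)).isLeft = true) :
    ∃ j hj, HasCup d j hj := by
  obtain ⟨j, hj⟩ := Sum.isLeft_iff.1 hi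
  rcases lt_trichotomy i j with h | h | h
  · obtain ⟨a, ha, _, hc⟩ := hd.exists_hasCup i j h hj (hw _)
    exact ⟨a, ha, hc⟩
  · rw [h] at hj
    exact absurd hj (d.partner_ne _)
  · obtain ⟨a, ha, _, hc⟩ := hd.exists_hasCup j i h (by rw [← hj, d.partner_partner]) (hw _)
    exact ⟨a, ha, hc⟩

/-- Both edges have n vertices: if every bottom vertex were joined to the top, these lines would use
up all the top vertices. -/
theorem exists_bottom_cup {d : Diagram n} (i : Fin n)
    (hi : (d.partner (Sum.inl i)).isLeft = true) :
    ∃ j : Fin n, (d.partner (Sum.inr j)).isRight = true := by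
  by_contra hcon
  push Not at hcon
  have hp' : ∀ j, ∃ k, d.partner (Sum.inr j) = Sum.inl k := fun j =>
    Sum.isLeft_iff.1 (by simpa using hcon j)
  choose g hg using hp'
  have hinj : Function.Injective g := by
    intro j k hjk
    have h1 : d.partner (Sum.inr j) = d.partner (Sum.inr k) := by rw [hg, hg, hjk]
    have h2 := congrArg d.partner h1
    rw [d.partner_partner, d.partner_partner] at h2
    exact Sum.inr_injective h2
  obtain ⟨j, rfl⟩ := Finite.surjective_of_injective hinj i
  rw [← hg, d.partner_partner] at hi
  simp at hi

/-- Moving a cup on the top leaves lines with both ends on the bottom alone, so the two cups can be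
moved independently. -/
theorem flip_moveCup_partner_inl (i : ℕ) (hi : i + 2 < n) (d : Diagram n) (j : Fin n)
    (q : Fin n) (h : (flip d).partner (Sum.inl j) = Sum.inl q) :
    (flip (moveCup i hi d)).partner (Sum.inl j) = Sum.inl q := by
  have h1 := flip_partner (flip d) (Sum.inl j)
  rw [flip_flip, h] at h1
  have h2 := moveCup_partner i hi d (Sum.inr j)
  have h3 := flip_partner (moveCup i hi d) (Sum.inr j)
  simp only [Sum.swap_inl, Sum.swap_inr] at h1 h2 h3
  rw [h1, shift_inr, shift_inr] at h2
  rw [h3, h2]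
  rfl

theorem HasCup.flip_moveCup {i : ℕ} {hi : i + 2 < n} {d : Diagram n} {j : ℕ} {hj : j + 1 < n}
    (h : HasCup (flip d) j hj) (hw : ∀ v, d.word v = []) :
    HasCup (flip (SymplecticBlob.moveCup i hi d)) j hj :=
  ⟨flip_moveCup_partner_inl i hi d _ _ h.1, by
    simp [flip, SymplecticBlob.moveCup, Decorated.relabel, hw]⟩

theorem GeneratorClosed.of_undecorated {G : Diagram n → Prop} (hG : GeneratorClosed G) (C : ℕ) :
    ∀ d, IsBasisDiagram d → (∀ v, d.word v = []) → cupCount d = C → G d := by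
  induction C using Nat.strong_induction_on with
  | _ C ih =>
    intro d hd hw hC
    have IH : ∀ d, IsBasisDiagram d → (∀ v, d.word v = []) → cupCount d < C → G d :=
      fun d hd hw hlt => ih _ hlt d hd hw rfl
    by_cases hprop : ∀ i, (d.partner (Sum.inl i)).isRight = true
    · rw [eq_identityDiagram hd.1.noncrossing hw hprop]
      exact hG.one
    push Not at hprop
    obtain ⟨i, hi⟩ := hprop
    have hi' : (d.partner (Sum.inl i)).isLeft = true := by simpa using hi
    obtain ⟨p, hp, htop⟩ := hd.exists_hasCup_of_isLeft hw i hi'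
    obtain ⟨j, hj⟩ := exists_bottom_cup i hi'
    have hwflip : ∀ d : Diagram n, (∀ v, d.word v = []) → ∀ v, (flip d).word v = [] := by
      intro d hw v
      simp [flip, Decorated.relabel, hw]
    have hwmove : ∀ i hi (d : Diagram n), (∀ v, d.word v = []) →
        ∀ v, (moveCup i hi d).word v = [] := by
      intro i hi d hw v
      simp [moveCup, Decorated.relabel, hw]
    obtain ⟨q, hq, hbot⟩ := hd.flip.exists_hasCup_of_isLeft (hwflip d hw) j (by
      have := flip_partner d (Sum.inr j)
      rw [Sum.swap_inr] at this
      rw [this]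
      simpa using hj)
    have hm : n - 2 + 2 = n := by omega
    -- The top cup goes to the right end first, while the bottom cup stays at `q`.
    refine hG.of_cup_last (n - 2) hm
      (fun d => (∀ v, d.word v = []) ∧ cupCount d = C ∧ HasCup (flip d) q hq)
      (fun i hi d h => ⟨hwmove i hi d h.1, by rw [cupCount_moveCup, h.2.1],
        h.2.2.flip_moveCup h.1⟩) ?_ (n - 2 - p) p hp d (by omega) hd ⟨hw, hC, hbot⟩ htop
    rintro d hd ⟨hw, hC, hbot⟩ htop
    -- The bottom cup is now moved as a top cup of the flipped diagram; the other cup, already at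
    -- the right end, stays there.
    have := hG.comp_flip.of_cup_last (n - 2) hm
      (fun d => (∀ v, d.word v = []) ∧ cupCount d = C ∧ HasCup (flip d) (n - 2) (by omega))
      (fun i hi d h => ⟨hwmove i hi d h.1, by rw [cupCount_moveCup, h.2.1],
        h.2.2.flip_moveCup h.1⟩) ?_ (n - 2 - q) q hq (flip d) (by omega) hd.flip
        ⟨hwflip d hw, by rw [cupCount_flip, hC], by rwa [flip_flip]⟩ hbot
    · rwa [flip_flip] at this
    · rintro d hd ⟨hw, hC, htop⟩ hbot
      exact hG.of_two_cups_last (n - 2) hm C IH hd.flip (hwflip d hw) (by rw [cupCount_flip, hC])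
        htop (by rwa [flip_flip])

/-- Every diagram of `B_n` can be built from the identity diagram by multiplications with generators
in which no scalars occur. -/
theorem GeneratorClosed.of_isBasisDiagram {G : Diagram n → Prop} (hG : GeneratorClosed G) (B : ℕ) :
    ∀ d, IsBasisDiagram d → blobCount d = B → G d := by
  induction B using Nat.strong_induction_on with
  | _ B ih =>
    intro d hd hB
    by_cases hw : ∀ v, d.word v = []
    · exact hG.of_undecorated _ d hd hw rfl
    · push Not at hw
      obtain ⟨v, hv⟩ := hw
      exact hG.of_blob B (fun d' hd' hlt => ih _ hlt d' hd' rfl) hd hB v hv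

end Undecorated

/-! ### From diagrams to the algebra. -/

section Generation

variable {k : Type*} [Field k] (P : Parameters k) (n : ℕ)

theorem IsGenerator.mem {g : Diagram n} (hg : IsGenerator g) :
    ∃ h : IsBasisDiagram g, diagramBasis P ⟨g, h⟩ ∈ generators P n := by
  rcases hg with rfl | rfl | ⟨i, hi, rfl⟩
  · exact ⟨_, Or.inl (Or.inl rfl)⟩
  · exact ⟨_, Or.inl (Or.inr rfl)⟩
  · exact ⟨_, Or.inr ⟨i, hi, rfl⟩⟩

/-- A scalar-free product of diagrams is an honest product of basis elements. Each step is a single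
multiplication by a generator, so associativity is not needed. -/
theorem generatorClosed_adjoin :
    GeneratorClosed fun d : Diagram n => ∀ h : IsBasisDiagram d, diagramBasis P ⟨d, h⟩ ∈
      NonUnitalAlgebra.adjoin k (insert 1 (generators P n)) where
  one _ := NonUnitalAlgebra.subset_adjoin k (Set.mem_insert _ _)
  mul_left g d r hg hd hr h hd' hr' := by
    obtain ⟨hgb, hgm⟩ := hg.mem P n
    rw [← GluesTo.mul_eq P (d := ⟨g, hgb⟩) (d' := ⟨d, hd⟩) (r := ⟨r, hr'⟩) h]
    exact mul_mem (NonUnitalAlgebra.subset_adjoin k (Set.mem_insert_of_mem _ hgm)) (hd' hd)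
  mul_right g d r hg hd hr h hd' hr' := by
    obtain ⟨hgb, hgm⟩ := hg.mem P n
    rw [← GluesTo.mul_eq P (d := ⟨d, hd⟩) (d' := ⟨g, hgb⟩) (r := ⟨r, hr'⟩) h]
    exact mul_mem (hd' hd) (NonUnitalAlgebra.subset_adjoin k (Set.mem_insert_of_mem _ hgm))

end Generation

end SymplecticBlob

theorem proposition2p4 {k : Type*} [Field k] (P : SymplecticBlob.Parameters k) (n : ℕ)
    (hn : 1 ≤ n) :
    NonUnitalAlgebra.adjoin k (insert 1 (SymplecticBlob.generators P n)) =
      (⊤ : NonUnitalSubalgebra k (SymplecticBlob.SymplecticBlobAlgebra P n)) := by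
  rw [eq_top_iff]
  intro x _
  -- By linearity it suffices that each basis diagram lies in the subalgebra.
  rw [← (SymplecticBlob.diagramBasis P).linearCombination_repr x, Finsupp.linearCombination_apply]
  exact sum_mem fun d _ => SMulMemClass.smul_mem _
    ((SymplecticBlob.generatorClosed_adjoin P n).of_isBasisDiagram _ d.1 d.2 rfl d.2)
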